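/- Let $N\ge 2$, let $E\subset\mathbb{R}^d$ be a bounded measurable set of positive Lebesgue measure, let $\Sigma$ be a positive definite $d\times d$ matrix, and let $\gamma>0$. For a design $X=(x_1,\dots,x_N)$ of points of $\mathbb{R}^d$ put $\delta_X=\min_{i\ne j}\|x_i-x_j\|$ (Euclidean norm) and $U(X)=\operatorname{diam}(E)-\delta_X$. Let $\operatorname{osc}(U)$ be the smallest $h\ge 0$ such that $U(Y)-U(X)\le h$ for all $X,Y\in E^N$. Let $\lambda_N$ be Lebesgue measure restricted to $E^N$, let $m=\sup\{a:\lambda_N(\{U<a\})=0\}$, and for $\varepsilon>0$ let $U^\varepsilon=\{X\in E^N: U(X)\le m+\varepsilon\}$. For a covariance matrix $S$ let $\phi(\cdot\mid\mu,S)$ be the Gaussian density on $\mathbb{R}^d$ with mean $\mu$ and covariance $S$, and let $G_{\mu,S}=\int_E\phi(y\mid\mu,S)\,dy$. Let $d^X_{i,j}=1/(\|x_i-x_j\|+\gamma)$, $D^X=\sum_{k<l}d^X_{k,l}$, and $$q_{\tau,i}(X,Y)=\phi(y_i\mid x_i,\tau\Sigma)\,G_{x_i,\tau\Sigma}^{-1}\sum_{j\ne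 i}\frac12\frac{d^X_{i,j}}{D^X}.$$ Consider the following simulated annealing algorithm with inverse temperatures $(\beta_n)_{n\ge0}$ and variance parameters $(\tau_n)_{n\ge0}$. The initial design $X^{(0)}$ has law $\eta$, an arbitrary probability measure on $E^N$. Given $X^{(0)},\dots,X^{(n)}$ with $X^{(n)}=X=(x_1,\dots,x_N)$, the design $X^{(n+1)}$ is obtained as follows: 1. draw a pair $\{i,j\}$ of distinct indices with probability $d^X_{i,j}/D^X$; 2. let $k$ be one of $i,j$, each with probability $\frac12$; 3. draw $y\in E$ from the Gaussian distribution with mean $x_k$ and covariance $\tau_n\Sigma$ constrained to $E$, that is, with density $\phi(y\mid x_k,\tau_n\Sigma)/G_{x_k,\tau_n\Sigma}$ on $E$, and let $Y$ be $X$ with $x_k$ replaced by $y$; 4. set $X^{(n+1)}=Y$ with probability $$\min\left(1,\ e^{-\beta_n(U(Y)-U(X))}\,\frac{q_{\tau_n,k}(Y,X)}{q_{\tau_n,k}(X,Y)}\right),$$ and $X^{(n+1)}=X$ otherwise. Theorem. Suppose that $\tau_0\ge\tau_n\ge\tau_{\min}>0$ for all $n\ge0$, and that $\beta_n=\frac1C\log(n+e)$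 for all $n\ge 0$, where $C>N\operatorname{osc}(U)$. Then for every $\varepsilon>0$ and every initial law $\eta$ on $E^N$, $$\lim_{n\to\infty}\mathbb{P}_\eta\big(X^{(n)}\in U^\varepsilon\big)=1.$$ -/

import Mathlib

open MeasureTheory ProbabilityTheory Filter Topology
open scoped ENNReal

noncomputable section

namespace Maximin

/-- Points of `ℝ^d`, with the Euclidean norm. -/
abbrev Point (d : ℕ) : Type := EuclideanSpace ℝ (Fin d)

/-- Designs: `N`-tuples of points of `ℝ^d`. -/
abbrev Design (N d : ℕ) : Type := Fin N → Point d

variable {N d : ℕ}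

/-- The designs with all points in `E`, that is, `E^N`. -/
def designs (N : ℕ) (E : Set (Point d)) : Set (Design N d) :=
  {X | ∀ i, X i ∈ E}

/-- Smallest distance between two points of the design with different indices. -/
def minDist (X : Design N d) : ℝ :=
  ⨅ p : {p : Fin N × Fin N // p.1 ≠ p.2}, dist (X p.1.1) (X p.1.2)

/-- The function to be minimized, `U(X) = diam(E) - δ_X`. -/
def U (E : Set (Point d)) (X : Design N d) : ℝ :=
  Metric.diam E - minDist X

/-- Oscillation of `U` on `E^N`: the smallest `h ≥ 0` with `U(Y) - U(X) ≤ h` there. -/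
def osc (N : ℕ) (E : Set (Point d)) : ℝ :=
  sInf {h : ℝ | 0 ≤ h ∧ ∀ X ∈ designs N E, ∀ Y ∈ designs N E, U E Y - U E X ≤ h}

/-- Lebesgue measure on `E^N`. -/
def lebN (N : ℕ) (E : Set (Point d)) : Measure (Design N d) :=
  volume.restrict (designs N E)

/-- The essential infimum `m` of `U` with respect to Lebesgue measure on `E^N`. -/
def minU (N : ℕ) (E : Set (Point d)) : ℝ :=
  sSup {a : ℝ | lebN N E {X | U E X < a} = 0}

/-- The set `U^ε` of `ε`-optimal designs. -/
def nearOptimal (N : ℕ) (E : Set (Point d)) (ε : ℝ) : Set (Design N d) :=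
  {X | X ∈ designs N E ∧ U E X ≤ minU N E + ε}

/-- The Gaussian density on `ℝ^d` with mean `μ` and covariance matrix `S`, evaluated at `y`. -/
def gaussDensity (μ : Point d) (S : Matrix (Fin d) (Fin d) ℝ) (y : Point d) : ℝ :=
  (Real.sqrt ((2 * Real.pi) ^ d * S.det))⁻¹ *
    Real.exp (-(1 / 2) * ((y - μ).ofLp ⬝ᵥ (S⁻¹).mulVec (y - μ).ofLp))

/-- Mass that the Gaussian with mean `μ` and covariance matrix `S` gives to `E`. -/
def gaussMass (E : Set (Point d)) (μ : Point d) (S : Matrix (Fin d) (Fin d) ℝ) : ℝ :=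
  ∫ y in E, gaussDensity μ S y

/-- The Gaussian distribution with mean `μ` and covariance matrix `S`, constrained to `E`. -/
def truncGauss (E : Set (Point d)) (μ : Point d) (S : Matrix (Fin d) (Fin d) ℝ) :
    Measure (Point d) :=
  (volume.restrict E).withDensity
    fun y => ENNReal.ofReal (gaussDensity μ S y / gaussMass E μ S)

/-- Unnormalized weight of the pair of indices `i`, `j`. -/
def pairWeight (γ : ℝ) (X : Design N d) (i j : Fin N) : ℝ :=
  1 / (dist (X i) (X j) + γ)

/-- Sum of the weights of all pairs `k < l`. -/
def totalWeight (γ : ℝ) (X : Design N d) : ℝ :=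
  ∑ p : Fin N × Fin N with p.1 < p.2, pairWeight γ X p.1 p.2

/-- Probability that the (unordered) pair `{i, j}` is drawn. -/
def pairProb (γ : ℝ) (X : Design N d) (i j : Fin N) : ℝ :=
  pairWeight γ X i j / totalWeight γ X

/-- `q_i(X, Y)`: density, at `Y i`, of selecting the index `i` and moving its point to `Y i`;
`S` is the covariance matrix of the random walk. -/
def proposalDensity (E : Set (Point d)) (S : Matrix (Fin d) (Fin d) ℝ) (γ : ℝ)
    (i : Fin N) (X Y : Design N d) : ℝ :=
  gaussDensity (X i) S (Y i) * (gaussMass E (X i) S)⁻¹ *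
    ∑ j : Fin N with j ≠ i, 1 / 2 * pairProb γ X i j

/-- Probability of accepting `Y`, proposed from `X` by moving the point of index `i`. -/
def acceptProb (E : Set (Point d)) (S : Matrix (Fin d) (Fin d) ℝ) (γ β : ℝ)
    (i : Fin N) (X Y : Design N d) : ℝ :=
  min 1 (Real.exp (-β * (U E Y - U E X)) *
    (proposalDensity E S γ i Y X / proposalDensity E S γ i X Y))

/-- Accept or reject: the law of the next state when `Y` is proposed from `X` by moving the
point of index `i`. -/
def acceptLaw (E : Set (Point d)) (S : Matrix (Fin d) (Fin d) ℝ) (γ β : ℝ)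
    (i : Fin N) (X Y : Design N d) : Measure (Design N d) :=
  ENNReal.ofReal (acceptProb E S γ β i X Y) • Measure.dirac Y +
    ENNReal.ofReal (1 - acceptProb E S γ β i X Y) • Measure.dirac X

/-- The law of the next state of the algorithm when the current state is `X`. The pair `{i, j}` is
drawn with probability `pairProb γ X i j`; its point `i` is selected with probability `1 / 2`; a new
position `y` is drawn from the constrained Gaussian; the new design is accepted or rejected. (The sum
is over ordered pairs, so each unordered pair contributes both of its points.) -/
def stepLaw (E : Set (Point d)) (S : Matrix (Fin d) (Fin d) ℝ) (γ β : ℝ)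
    (X : Design N d) : Measure (Design N d) :=
  ∑ i : Fin N, ∑ j : Fin N with j ≠ i, ENNReal.ofReal (1 / 2 * pairProb γ X i j) •
    (truncGauss E (X i) S).bind fun y => acceptLaw E S γ β i X (Function.update X i y)

/-! Measurability of the objects above, so that `stepLaw` is a kernel. -/

theorem measurable_minDist : Measurable (minDist : Design N d → ℝ) := by
  unfold minDist
  exact Measurable.iInf fun p => by fun_prop

theorem measurable_U (E : Set (Point d)) : Measurable (U E : Design N d → ℝ) :=
  measurable_const.sub measurable_minDist

theorem continuous_gaussDensity (S : Matrix (Fin d) (Fin d) ℝ) :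
    Continuous fun p : Point d × Point d => gaussDensity p.1 S p.2 := by
  have h : Continuous fun p : Point d × Point d => (p.2 - p.1).ofLp :=
    (PiLp.continuous_ofLp 2 _).comp (continuous_snd.sub continuous_fst)
  unfold gaussDensity
  exact continuous_const.mul (Real.continuous_exp.comp
    (continuous_const.mul (h.dotProduct (continuous_const.matrix_mulVec h))))

theorem measurable_gaussMass (E : Set (Point d)) (S : Matrix (Fin d) (Fin d) ℝ) :
    Measurable fun x : Point d => gaussMass E x S :=
  ((continuous_gaussDensity S).stronglyMeasurable.integral_prod_right
    (ν := volume.restrict E)).measurable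

theorem measurable_pairProb (γ : ℝ) (i j : Fin N) :
    Measurable fun X : Design N d => pairProb γ X i j := by
  unfold pairProb totalWeight pairWeight
  refine Measurable.div (by fun_prop) (Finset.measurable_sum _ fun p _ => by fun_prop)

theorem measurable_proposalDensity (E : Set (Point d)) (S : Matrix (Fin d) (Fin d) ℝ) (γ : ℝ)
    (i : Fin N) :
    Measurable fun p : Design N d × Design N d => proposalDensity E S γ i p.1 p.2 := by
  have h1 : Measurable fun p : Design N d × Design N d => gaussDensity (p.1 i) S (p.2 i) :=
    (continuous_gaussDensity S).measurable.comp
      (f := fun p : Design N d × Design N d => (p.1 i, p.2 i)) (by fun_prop)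
  have h2 : Measurable fun p : Design N d × Design N d => gaussMass E (p.1 i) S :=
    (measurable_gaussMass E S).comp (f := fun p : Design N d × Design N d => p.1 i) (by fun_prop)
  exact (h1.mul h2.inv).mul (Finset.measurable_sum _ fun j _ =>
    measurable_const.mul ((measurable_pairProb γ i j).comp measurable_fst))

theorem measurable_acceptProb (E : Set (Point d)) (S : Matrix (Fin d) (Fin d) ℝ) (γ β : ℝ)
    (i : Fin N) :
    Measurable fun p : Design N d × Design N d => acceptProb E S γ β i p.1 p.2 := by
  have hq := measurable_proposalDensity (N := N) E S γ i
  have hU := measurable_U (N := N) E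
  exact measurable_const.min ((Real.measurable_exp.comp (measurable_const.mul
    ((hU.comp measurable_snd).sub (hU.comp measurable_fst)))).mul
      ((hq.comp measurable_swap).div hq))

theorem measurable_acceptLaw (E : Set (Point d)) (S : Matrix (Fin d) (Fin d) ℝ) (γ β : ℝ)
    (i : Fin N) :
    Measurable fun p : Design N d × Design N d => acceptLaw E S γ β i p.1 p.2 := by
  have ha := measurable_acceptProb (N := N) E S γ β i
  refine Measure.measurable_of_measurable_coe _ fun A hA => ?_
  have h1 : Measurable fun p : Design N d × Design N d => Measure.dirac p.1 A :=
    (Measure.measurable_coe hA).comp (Measure.measurable_dirac.comp measurable_fst)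
  have h2 : Measurable fun p : Design N d × Design N d => Measure.dirac p.2 A :=
    (Measure.measurable_coe hA).comp (Measure.measurable_dirac.comp measurable_snd)
  simp only [acceptLaw, Measure.add_apply, Measure.smul_apply, smul_eq_mul]
  exact (ha.ennreal_ofReal.mul h2).add ((measurable_const.sub ha).ennreal_ofReal.mul h1)

theorem measurable_update_pair (i : Fin N) :
    Measurable fun p : Design N d × Point d => (p.1, Function.update p.1 i p.2) := by
  refine measurable_fst.prodMk (measurable_pi_lambda _ fun k => ?_)
  by_cases h : k = i
  · subst h; simpa using measurable_snd
  · simp only [ne_eq, h, not_false_eq_true, Function.update_of_ne]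
    exact (measurable_pi_apply k).comp measurable_fst

theorem measurable_acceptLaw_update (E : Set (Point d)) (S : Matrix (Fin d) (Fin d) ℝ) (γ β : ℝ)
    (i : Fin N) :
    Measurable fun p : Design N d × Point d =>
      acceptLaw E S γ β i p.1 (Function.update p.1 i p.2) := by
  have h := measurable_acceptLaw (N := N) E S γ β i
  have hu := measurable_update_pair (N := N) (d := d) i
  have hc := h.comp hu
  simp only [Function.comp_def] at hc
  exact hc

theorem measurable_truncDensity (E : Set (Point d)) (S : Matrix (Fin d) (Fin d) ℝ) :
    Measurable fun p : Point d × Point d =>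
      ENNReal.ofReal (gaussDensity p.1 S p.2 / gaussMass E p.1 S) := by
  have h1 := (continuous_gaussDensity (d := d) S).measurable
  have h2 : Measurable fun p : Point d × Point d => gaussMass E p.1 S :=
    (measurable_gaussMass E S).comp measurable_fst
  have h3 := (h1.div h2).ennreal_ofReal
  exact h3

theorem bind_truncGauss_apply {β : Type*} [MeasurableSpace β] (E : Set (Point d))
    (S : Matrix (Fin d) (Fin d) ℝ) (x : Point d) {f : Point d → Measure β} (hf : Measurable f)
    {A : Set β} (hA : MeasurableSet A) :
    (truncGauss E x S).bind f A =
      ∫⁻ y in E, ENNReal.ofReal (gaussDensity x S y / gaussMass E x S) * f y A := by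
  have hg : Measurable fun y : Point d =>
      ENNReal.ofReal (gaussDensity x S y / gaussMass E x S) := by
    have hc := (measurable_truncDensity E S).comp (measurable_prodMk_left (x := x))
    exact hc
  have hfA : Measurable fun y => f y A := (Measure.measurable_coe hA).comp hf
  rw [Measure.bind_apply hA hf.aemeasurable, truncGauss]
  exact lintegral_withDensity_eq_lintegral_mul _ hg hfA

theorem measurable_stepLaw (E : Set (Point d)) (S : Matrix (Fin d) (Fin d) ℝ) (γ β : ℝ) :
    Measurable (stepLaw E S γ β : Design N d → Measure (Design N d)) := by
  refine Measure.measurable_of_measurable_coe _ fun A hA => ?_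
  have key : ∀ i : Fin N, Measurable fun X : Design N d =>
      (truncGauss E (X i) S).bind
        (fun y => acceptLaw E S γ β i X (Function.update X i y)) A := by
    intro i
    have hm := measurable_acceptLaw_update (N := N) E S γ β i
    have hg : Measurable fun p : Design N d × Point d =>
        ENNReal.ofReal (gaussDensity (p.1 i) S p.2 / gaussMass E (p.1 i) S) :=
      (measurable_truncDensity E S).comp
        (f := fun p : Design N d × Point d => (p.1 i, p.2)) (by fun_prop)
    have hmA : Measurable fun p : Design N d × Point d =>
        acceptLaw E S γ β i p.1 (Function.update p.1 i p.2) A :=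
      (Measure.measurable_coe hA).comp hm
    have heq : ∀ X : Design N d, (truncGauss E (X i) S).bind
        (fun y => acceptLaw E S γ β i X (Function.update X i y)) A =
        ∫⁻ y in E, ENNReal.ofReal (gaussDensity (X i) S y / gaussMass E (X i) S) *
          acceptLaw E S γ β i X (Function.update X i y) A := by
      intro X
      have hmX := hm.comp (measurable_prodMk_left (x := X))
      exact bind_truncGauss_apply E S (X i) hmX hA
    have hI := (hg.mul hmA).lintegral_prod_right' (ν := volume.restrict E)
    simp only [heq]
    exact hI
  have hs : ∀ i j : Fin N, Measurable fun X : Design N d =>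
      ENNReal.ofReal (1 / 2 * pairProb γ X i j) * (truncGauss E (X i) S).bind
        (fun y => acceptLaw E S γ β i X (Function.update X i y)) A := by
    intro i j
    have hw := ((measurable_pairProb (d := d) γ i j).const_mul (1 / 2)).ennreal_ofReal
    have hk := hw.mul (key i)
    exact hk
  simp only [stepLaw, Measure.finsetSum_apply, Measure.smul_apply, smul_eq_mul]
  exact Finset.measurable_sum _ fun i _ => Finset.measurable_sum _ fun j _ => hs i j

/-- The transition kernel of the algorithm, at inverse temperature `β`, when the covariance matrix of
the random walk is `S`. -/
def stepKernel (E : Set (Point d)) (S : Matrix (Fin d) (Fin d) ℝ) (γ β : ℝ) :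
    Kernel (Design N d) (Design N d) where
  toFun := stepLaw E S γ β
  measurable' := measurable_stepLaw E S γ β

/-- `X` is a (time-inhomogeneous) Markov chain with initial law `η`, and `κ n` is the kernel of its
transition from time `n` to time `n + 1`, given the whole past. -/
structure IsMarkovChain {Ω α : Type*} [MeasurableSpace Ω] [MeasurableSpace α] (P : Measure Ω)
    (η : Measure α) (κ : ℕ → Kernel α α) (X : ℕ → Ω → α) : Prop where
  measurable : ∀ n, Measurable (X n)
  initial : P.map (X 0) = η
  transition : ∀ n, ∀ A : Set α, MeasurableSet A →
    P⟦X (n + 1) ⁻¹' A | ⨆ k : Fin (n + 1), MeasurableSpace.comap (X k) inferInstance⟧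
      =ᵐ[P] fun ω => (κ n (X n ω)).real A

end Maximin

end

/-! Two facts concern the Gibbs laws `gibbsProb N E β`, with density proportional to exp(-βU) on
E^N. The kernel at inverse temperature β leaves the Gibbs law invariant (`gibbs_bind_stepKernel`),
because Metropolis–Hastings acceptance makes the flow of accepted moves symmetric. As β → ∞ the
Gibbs law concentrates on near-optimal designs (`tendsto_gibbsProb_nearOptimal`). It remains to see
that the law ν_n of the chain catches up with the Gibbs law at β_n. Closeness is expressed by
domination: s • Gibbs ≤ ν_n with s close to 1.

Time is cut into blocks of N steps. In one block every coordinate can be resampled once, each time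
with density at least c·exp(-β·osc) whatever the current design, so a block dominates a multiple
c^N·exp(-βN·osc) of Lebesgue measure (`smul_lebN_le_iterBind`). For each δ > 0, Lebesgue measure in
turn dominates a constant times exp(-2βδ) times the Gibbs law (`smul_gibbsProb_le_lebN`). With β_n =
log(n+e)/C the part of ν_n not yet covered is thus converted at a rate a_n of order n^(-θ), where θ
= (N·osc+2δ)/C < 1 for small δ; these rates have a divergent sum. The drift of the Gibbs law during
a block loses only a fraction 1 - b_n = O(1/n) = o(a_n).

The uncovered fraction x therefore satisfies x_{k+1} ≤ (1 - a_k) x_k + (1 - b_k) and tends to 0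
(`smul_le_iterBind`, `tendsto_zero_of_le_one_sub_mul_add`). -/

noncomputable section

namespace Maximin

/-! ### Sequences of real numbers -/

/-- The recursion advances by blocks of `N` steps, so limits are obtained along each residue class
mod `N` and glued here. -/
theorem tendsto_of_forall_residue {α : Type*} {l : Filter α} {N : ℕ} (hN : 0 < N) {f : ℕ → α}
    (h : ∀ r < N, Tendsto (fun k => f (r + N * k)) atTop l) : Tendsto f atTop l := by
  intro s hs
  have h1 : ∀ᶠ k in atTop, ∀ r ∈ Finset.range N, f (r + N * k) ∈ s :=
    (Finset.eventually_all _).2 fun r hr => h r (Finset.mem_range.1 hr) hs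
  have h2 : Tendsto (fun n => n / N) atTop atTop := Nat.tendsto_div_const_atTop hN.ne'
  change ∀ᶠ n in atTop, f n ∈ s
  filter_upwards [h2.eventually h1] with n hn
  have := hn (n % N) (Finset.mem_range.2 (Nat.mod_lt _ hN))
  rwa [Nat.mod_add_div] at this

/-- Contractions with divergent total rate erase the initial value, and an input negligible against
the rate leaves no residue. -/
theorem tendsto_zero_of_le_one_sub_mul_add {x a b : ℕ → ℝ} (hx : ∀ k, 0 ≤ x k)
    (ha0 : ∀ k, 0 ≤ a k) (ha1 : ∀ k, a k ≤ 1) (ha : ¬ Summable a)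
    (hb : ∀ δ : ℝ, 0 < δ → ∀ᶠ k in atTop, b k ≤ δ * a k)
    (hrec : ∀ k, x (k + 1) ≤ (1 - a k) * x k + b k) : Tendsto x atTop (𝓝 0) := by
  have key : ∀ δ : ℝ, 0 < δ → ∀ᶠ k in atTop, x k < δ := by
    intro δ hδ
    obtain ⟨K, hK⟩ := eventually_atTop.1 (hb (δ / 2) (by positivity))
    -- `δ / 2` is the fixed point of t ↦ (1 - a) t + (δ/2) a, so only the excess over it evolves,
    -- shrinking by 1 - a ≤ exp(-a) each time.
    have hstep : ∀ k, x (K + k) ≤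
        δ / 2 + x K * Real.exp (-∑ j ∈ Finset.range k, a (K + j)) := by
      intro k
      induction k with
      | zero => simp; positivity
      | succ k ih =>
        have h1 := hrec (K + k)
        have h2 := hK (K + k) (by omega)
        have h3 : 1 - a (K + k) ≤ Real.exp (-a (K + k)) := by
          have := Real.add_one_le_exp (-a (K + k)); linarith
        have h4 : 0 ≤ 1 - a (K + k) := by linarith [ha1 (K + k)]
        rw [Finset.sum_range_succ, neg_add, Real.exp_add]
        set e := Real.exp (-∑ j ∈ Finset.range k, a (K + j))
        have he : 0 ≤ x K * e := mul_nonneg (hx K) (Real.exp_pos _).le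
        calc x (K + (k + 1)) ≤ (1 - a (K + k)) * x (K + k) + b (K + k) := h1
          _ ≤ (1 - a (K + k)) * (δ / 2 + x K * e) + δ / 2 * a (K + k) :=
              add_le_add (mul_le_mul_of_nonneg_left ih h4) h2
          _ = δ / 2 + (1 - a (K + k)) * (x K * e) := by ring
          _ ≤ δ / 2 + Real.exp (-a (K + k)) * (x K * e) := by gcongr
          _ = _ := by ring
    have hdiv : Tendsto (fun k => ∑ j ∈ Finset.range k, a (K + j)) atTop atTop := by
      refine (not_summable_iff_tendsto_nat_atTop_of_nonneg fun j => ha0 _).1 ?_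
      intro hs
      refine ha ((summable_nat_add_iff K).1 ?_)
      simpa only [add_comm] using hs
    have hlim : Tendsto (fun k => δ / 2 +
        x K * Real.exp (-∑ j ∈ Finset.range k, a (K + j))) atTop (𝓝 (δ / 2 + x K * 0)) :=
      tendsto_const_nhds.add
        (tendsto_const_nhds.mul (Real.tendsto_exp_neg_atTop_nhds_zero.comp hdiv))
    have hev := hlim.eventually (gt_mem_nhds (show δ / 2 + x K * 0 < δ by linarith))
    obtain ⟨M, hM⟩ := eventually_atTop.1 hev
    refine eventually_atTop.2 ⟨K + M, fun k hk => ?_⟩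
    have := hstep (k - K)
    rw [show K + (k - K) = k by omega] at this
    exact this.trans_lt (hM _ (by omega))
  rw [Metric.tendsto_nhds]
  intro δ hδ
  filter_upwards [key δ hδ] with k hk
  rwa [Real.dist_eq, sub_zero, abs_of_nonneg (hx k)]

/-! ### Product measures -/

theorem measurable_prodMk_update {ι α : Type*} [DecidableEq ι] [MeasurableSpace α] (i : ι) :
    Measurable fun p : (ι → α) × α => (p.1, Function.update p.1 i p.2) := by
  refine measurable_fst.prodMk (measurable_pi_lambda _ fun k => ?_)
  by_cases h : k = i
  · subst h; simpa using measurable_snd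
  · simp only [ne_eq, h, not_false_eq_true, Function.update_of_ne]
    exact (measurable_pi_apply k).comp measurable_fst

/-- Once the other coordinates are frozen, this is Tonelli for two independent copies of coordinate
`i`, the old one and the new one. -/
theorem lintegral_pi_update_swap {ι α : Type*} [Fintype ι] [DecidableEq ι] [MeasurableSpace α]
    (μ : ι → Measure α) [∀ i, SigmaFinite (μ i)] (i : ι)
    {F : (ι → α) → (ι → α) → ℝ≥0∞} (hF : Measurable fun p : (ι → α) × (ι → α) => F p.1 p.2) :
    ∫⁻ x, ∫⁻ y, F x (Function.update x i y) ∂μ i ∂Measure.pi μ =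
      ∫⁻ x, ∫⁻ y, F (Function.update x i y) x ∂μ i ∂Measure.pi μ := by
  have hu : Measurable fun p : (ι → α) × α => Function.update p.1 i p.2 :=
    measurable_snd.comp (measurable_prodMk_update i)
  have h1 : Measurable fun p : (ι → α) × α => F p.1 (Function.update p.1 i p.2) :=
    hF.comp (measurable_fst.prodMk hu)
  have h2 : Measurable fun p : (ι → α) × α => F (Function.update p.1 i p.2) p.1 :=
    hF.comp (hu.prodMk measurable_fst)
  refine lintegral_eq_of_lmarginal_eq {i} h1.lintegral_prod_right' h2.lintegral_prod_right' ?_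
  rw [lmarginal_singleton, lmarginal_singleton]
  funext x
  simp only [Function.update_idem]
  refine lintegral_lintegral_swap ?_
  have hx : ∀ g : α × α → α, Measurable g → Measurable fun p => Function.update x i (g p) :=
    fun g hg => hu.comp (measurable_const.prodMk hg)
  exact (hF.comp ((hx _ measurable_fst).prodMk (hx _ measurable_snd))).aemeasurable

/-- Abstract detailed balance: `F` is the symmetric flow of accepted moves, `G` collects the
rejected ones, and the test function `h` passes from the arrival point to the departure point. -/
theorem lintegral_pi_update_symm {ι α : Type*} [Fintype ι] [DecidableEq ι] [MeasurableSpace α]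
    (μ : ι → Measure α) [∀ i, SigmaFinite (μ i)] (i : ι)
    {F G : (ι → α) → (ι → α) → ℝ≥0∞} {h : (ι → α) → ℝ≥0∞}
    (hF : Measurable fun p : (ι → α) × (ι → α) => F p.1 p.2)
    (hG : Measurable fun p : (ι → α) × (ι → α) => G p.1 p.2) (hh : Measurable h)
    (hsymm : ∀ x y, F x y = F y x) :
    ∫⁻ x, ∫⁻ y, (F x (Function.update x i y) * h (Function.update x i y) +
        G x (Function.update x i y)) ∂μ i ∂Measure.pi μ =
      ∫⁻ x, ∫⁻ y, (F x (Function.update x i y) * h x +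
        G x (Function.update x i y)) ∂μ i ∂Measure.pi μ := by
  have hu := measurable_prodMk_update (α := α) i
  have hGu : Measurable fun p : (ι → α) × α => G p.1 (Function.update p.1 i p.2) := hG.comp hu
  have hG1 : ∀ x, Measurable fun y => G x (Function.update x i y) := fun x =>
    hGu.comp (measurable_prodMk_left (x := x))
  have hG2 : Measurable fun x => ∫⁻ y, G x (Function.update x i y) ∂μ i :=
    hGu.lintegral_prod_right'
  have hFh : Measurable fun p : (ι → α) × (ι → α) => F p.1 p.2 * h p.2 :=
    hF.mul (hh.comp measurable_snd)
  simp_rw [lintegral_add_right _ (hG1 _)]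
  rw [lintegral_add_right _ hG2, lintegral_add_right _ hG2,
    lintegral_pi_update_swap μ i (F := fun x y => F x y * h y) hFh]
  simp only [hsymm (Function.update _ _ _)]

/-- If every `κ j` dominates, up to the factor `c j`, the resampling of the coordinate `j`, then
running through all the coordinates dominates the product measure. -/
theorem smul_pi_le_of_resample_le {N : ℕ} {α : Type*} [MeasurableSpace α]
    (μ : Fin N → Measure α) [∀ i, SigmaFinite (μ i)] (ρ : ℕ → Measure (Fin N → α))
    (c : ℕ → ℝ≥0∞)
    (h : ∀ i : Fin N, ∀ f : (Fin N → α) → ℝ≥0∞, Measurable f →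
      c i * ∫⁻ x, ∫⁻ y, f (Function.update x i y) ∂μ i ∂ρ i ≤ ∫⁻ x, f x ∂ρ (i + 1)) :
    ((∏ j ∈ Finset.range N, c j) * ρ 0 Set.univ) • Measure.pi μ ≤ ρ N := by
  -- Induction on the number of coordinates already refreshed; at each stage the hypothesis is
  -- applied to the integral of `f` over the newest coordinate.
  have key : ∀ n ≤ N, ∀ f : (Fin N → α) → ℝ≥0∞, Measurable f →
      (∏ j ∈ Finset.range n, c j) *
        ∫⁻ x, (∫⋯∫⁻_(Finset.univ.filter fun i : Fin N => (i : ℕ) < n), f ∂μ) x ∂ρ 0 ≤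
      ∫⁻ x, f x ∂ρ n := by
    intro n
    induction n with
    | zero => intro _ f _; simp
    | succ n ih =>
      intro hn f hf
      let i : Fin N := ⟨n, hn⟩
      have hs : (Finset.univ.filter fun k : Fin N => (k : ℕ) < n + 1) =
          insert i (Finset.univ.filter fun k : Fin N => (k : ℕ) < n) := by
        ext k; simp [i, Fin.ext_iff]; omega
      have hi : i ∉ Finset.univ.filter fun k : Fin N => (k : ℕ) < n := by simp [i]
      have hm : Measurable fun x => ∫⁻ y, f (Function.update x i y) ∂μ i := by
        have := hf.lmarginal μ (s := {i})
        rwa [lmarginal_singleton] at this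
      rw [hs, lmarginal_insert' f hf hi, Finset.prod_range_succ, mul_comm _ (c n), mul_assoc]
      exact (mul_le_mul_right (ih (by omega) _ hm) _).trans (h i f hf)
  refine Measure.le_iff.2 fun A hA => ?_
  have := key N le_rfl (A.indicator 1) (measurable_one.indicator hA)
  have hu : (Finset.univ.filter fun i : Fin N => (i : ℕ) < N) = Finset.univ := by ext; simp
  rw [hu, lmarginal_univ, lintegral_const, lintegral_indicator_one hA,
    lintegral_indicator_one hA] at this
  rw [Measure.smul_apply, smul_eq_mul]
  calc _ = (∏ j ∈ Finset.range N, c j) * (Measure.pi μ A * ρ 0 Set.univ) := by ring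
    _ ≤ _ := this

/-! ### Markov chains -/

/-- Taking expectations in the conditional probabilities leaves a recursion for the one-time laws,
which is all that the convergence uses. -/
theorem IsMarkovChain.map_succ {Ω α : Type*} [MeasurableSpace Ω] [MeasurableSpace α]
    {P : Measure Ω} [IsProbabilityMeasure P] {η : Measure α} {κ : ℕ → Kernel α α}
    [∀ n, IsMarkovKernel (κ n)] {X : ℕ → Ω → α} (h : IsMarkovChain P η κ X) (n : ℕ) :
    P.map (X (n + 1)) = (P.map (X n)).bind (κ n) := by
  have hm : (⨆ k : Fin (n + 1), MeasurableSpace.comap (X k) inferInstance) ≤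
      (inferInstance : MeasurableSpace Ω) :=
    iSup_le fun k => (h.measurable k).comap_le
  ext A hA
  have hXA : MeasurableSet (X (n + 1) ⁻¹' A) := h.measurable (n + 1) hA
  have hκ : Measurable fun x => κ n x A := Kernel.measurable_coe _ hA
  rw [Measure.map_apply (h.measurable _) hA, Measure.bind_apply hA (κ n).measurable.aemeasurable,
    lintegral_map hκ (h.measurable n)]
  have h1 : ∫ ω, (P⟦X (n + 1) ⁻¹' A |
      ⨆ k : Fin (n + 1), MeasurableSpace.comap (X k) inferInstance⟧) ω ∂P =
      P.real (X (n + 1) ⁻¹' A) := by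
    rw [integral_condExp hm, integral_indicator_const _ hXA, smul_eq_mul, mul_one]
  rw [integral_congr_ae (h.transition n A hA)] at h1
  have h2 : ∫ ω, (κ n (X n ω)).real A ∂P = (∫⁻ ω, κ n (X n ω) A ∂P).toReal :=
    integral_toReal (hκ.comp (h.measurable n)).aemeasurable
      (Eventually.of_forall fun ω => measure_lt_top _ _)
  have h3 : ∫⁻ ω, κ n (X n ω) A ∂P ≠ ∞ := by
    refine ((lintegral_mono fun ω => (prob_le_one : κ n (X n ω) A ≤ 1)).trans_lt ?_).ne
    simp
  rw [h2] at h1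
  exact ((ENNReal.toReal_eq_toReal_iff' h3 (measure_ne_top _ _)).1 h1).symm

section

variable {N d : ℕ} {E : Set (Point d)} {S : Matrix (Fin d) (Fin d) ℝ} {γ β : ℝ}

/-! ### The space of designs and the objective function -/

theorem designs_eq_pi (E : Set (Point d)) : designs N E = Set.univ.pi fun _ => E := by
  ext X; simp [designs]

theorem measurableSet_designs (hE : MeasurableSet E) : MeasurableSet (designs N E) := by
  rw [designs_eq_pi]
  exact MeasurableSet.univ_pi fun _ => hE

theorem lebN_eq_pi (E : Set (Point d)) :
    lebN N E = Measure.pi fun _ : Fin N => volume.restrict E := by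
  rw [lebN, designs_eq_pi, volume_pi, Measure.restrict_pi_pi]

theorem lebN_univ (E : Set (Point d)) : lebN N E Set.univ = volume E ^ N := by
  rw [lebN_eq_pi, Measure.pi_univ]; simp

theorem isFiniteMeasure_lebN (hb : Bornology.IsBounded E) : IsFiniteMeasure (lebN N E) :=
  ⟨by rw [lebN_univ]; exact ENNReal.pow_lt_top hb.measure_lt_top⟩

theorem update_mem_designs {X : Design N d} (hX : X ∈ designs N E) (i : Fin N) {y : Point d}
    (hy : y ∈ E) : Function.update X i y ∈ designs N E := by
  intro k
  by_cases h : k = i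
  · subst h; simpa using hy
  · simpa [h] using hX k

theorem minDist_nonneg (X : Design N d) : 0 ≤ minDist X :=
  Real.iInf_nonneg fun _ => dist_nonneg

theorem minDist_le_diam (hN : 2 ≤ N) (hb : Bornology.IsBounded E) {X : Design N d}
    (hX : X ∈ designs N E) : minDist X ≤ Metric.diam E := by
  have hne : (⟨0, by omega⟩ : Fin N) ≠ ⟨1, by omega⟩ := by simp
  refine (ciInf_le ⟨0, ?_⟩ (⟨(_, _), hne⟩ : {p : Fin N × Fin N // p.1 ≠ p.2})).trans
    (Metric.dist_le_diam_of_mem hb (hX _) (hX _))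
  rintro _ ⟨p, rfl⟩
  exact dist_nonneg

theorem U_nonneg (hN : 2 ≤ N) (hb : Bornology.IsBounded E) {X : Design N d}
    (hX : X ∈ designs N E) : 0 ≤ U E X :=
  sub_nonneg.2 (minDist_le_diam hN hb hX)

theorem U_le_diam (X : Design N d) : U E X ≤ Metric.diam E :=
  sub_le_self _ (minDist_nonneg X)

theorem osc_nonneg (N : ℕ) (E : Set (Point d)) : 0 ≤ osc N E :=
  Real.sInf_nonneg fun _ h => h.1

theorem U_sub_le_osc (hN : 2 ≤ N) (hb : Bornology.IsBounded E) {X Y : Design N d}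
    (hX : X ∈ designs N E) (hY : Y ∈ designs N E) : U E Y - U E X ≤ osc N E := by
  -- The bound `Metric.diam E` makes the set of admissible `h` nonempty, so its `sInf` is a genuine
  -- infimum.
  refine le_csInf ⟨Metric.diam E, Metric.diam_nonneg, fun X hX Y _ => ?_⟩ fun h hh => hh.2 X hX Y hY
  linarith [U_nonneg hN hb hX, U_le_diam (E := E) Y]

/-- Otherwise `minU N E + ε` would itself belong to the set whose supremum is `minU N E`. That set
is bounded because U ≤ diam(E) and E^N is not null. -/
theorem lebN_U_lt_pos (hpos : 0 < volume E) {ε : ℝ} (hε : 0 < ε) :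
    0 < lebN N E {X | U E X < minU N E + ε} := by
  have hbdd : BddAbove {a : ℝ | lebN N E {X | U E X < a} = 0} := by
    refine ⟨Metric.diam E, fun a ha => ?_⟩
    by_contra! hlt
    have : {X : Design N d | U E X < a} = Set.univ :=
      Set.eq_univ_of_forall fun X => (U_le_diam X).trans_lt hlt
    rw [Set.mem_ofPred_eq, this, lebN_univ] at ha
    exact pow_ne_zero N hpos.ne' ha
  rw [pos_iff_ne_zero]
  intro h
  have : minU N E + ε ≤ minU N E := le_csSup hbdd h
  linarith

/-- With the slack `ε` a single admissible threshold below `minU N E` suffices, and no countable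
limit is needed. The estimate using this bound has such a slack anyway. -/
theorem ae_minU_sub_le (hN : 2 ≤ N) (hb : Bornology.IsBounded E)
    {ε : ℝ} (hε : 0 < ε) : ∀ᵐ X ∂lebN N E, minU N E - ε ≤ U E X := by
  have hne : {a : ℝ | lebN N E {X | U E X < a} = 0}.Nonempty := by
    refine ⟨0, ?_⟩
    rw [Set.mem_ofPred_eq, lebN, Measure.restrict_apply (measurableSet_lt (measurable_U E)
      measurable_const)]
    refine measure_mono_null (t := ∅) ?_ measure_empty
    rintro X ⟨h, hX⟩
    exact absurd h (not_lt.2 (U_nonneg hN hb hX))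
  obtain ⟨a, ha, hlt⟩ := exists_lt_of_lt_csSup hne (show minU N E - ε < minU N E by linarith)
  have ha' : ∀ᵐ X ∂lebN N E, ¬ U E X < a := measure_eq_zero_iff_ae_notMem.1 ha
  filter_upwards [ha'] with X hX
  linarith [not_lt.1 hX]

/-! ### The Gaussian densities -/

theorem gaussDensity_factor_pos (hS : S.PosDef) :
    0 < (Real.sqrt ((2 * Real.pi) ^ d * S.det))⁻¹ := by
  have := hS.det_pos
  have := Real.pi_pos
  positivity

theorem gaussDensity_pos (hS : S.PosDef) (x y : Point d) : 0 < gaussDensity x S y :=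
  mul_pos (gaussDensity_factor_pos hS) (Real.exp_pos _)

theorem quadForm_inv_nonneg (hS : S.PosDef) (v : Fin d → ℝ) : 0 ≤ v ⬝ᵥ (S⁻¹).mulVec v := by
  simpa using hS.inv.posSemidef.dotProduct_mulVec_nonneg v

theorem gaussDensity_le (hS : S.PosDef) (x y : Point d) :
    gaussDensity x S y ≤ (Real.sqrt ((2 * Real.pi) ^ d * S.det))⁻¹ := by
  refine mul_le_of_le_one_right (gaussDensity_factor_pos hS).le (Real.exp_le_one_iff.2 ?_)
  have := quadForm_inv_nonneg hS (y - x).ofLp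
  linarith

theorem continuous_gaussDensity_right (S : Matrix (Fin d) (Fin d) ℝ) (x : Point d) :
    Continuous (gaussDensity x S) :=
  (continuous_gaussDensity S).comp (Continuous.prodMk_right x)

theorem integrableOn_gaussDensity (hS : S.PosDef) (hb : Bornology.IsBounded E) (x : Point d) :
    IntegrableOn (gaussDensity x S) E := by
  refine Measure.integrableOn_of_bounded hb.measure_lt_top.ne
    (continuous_gaussDensity_right S x).aestronglyMeasurable
    (M := (Real.sqrt ((2 * Real.pi) ^ d * S.det))⁻¹) (Eventually.of_forall fun y => ?_)
  rw [Real.norm_of_nonneg (gaussDensity_pos hS x y).le]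
  exact gaussDensity_le hS x y

theorem gaussMass_pos (hS : S.PosDef) (hb : Bornology.IsBounded E) (hpos : 0 < volume E)
    (x : Point d) : 0 < gaussMass E x S := by
  refine (integral_pos_iff_support_of_nonneg (fun y => (gaussDensity_pos hS x y).le)
    (integrableOn_gaussDensity hS hb x)).2 ?_
  have : Function.support (gaussDensity x S) = Set.univ :=
    Set.eq_univ_of_forall fun y => (gaussDensity_pos hS x y).ne'
  simpa [this] using hpos

theorem gaussMass_le (hS : S.PosDef) (hb : Bornology.IsBounded E) (x : Point d) :
    gaussMass E x S ≤ (Real.sqrt ((2 * Real.pi) ^ d * S.det))⁻¹ * volume.real E := by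
  have h := integral_mono (integrableOn_gaussDensity hS hb x)
    (integrableOn_const hb.measure_lt_top.ne) fun y => gaussDensity_le hS x y
  simpa [gaussMass, mul_comm] using h

theorem lintegral_gaussDensity_div (hS : S.PosDef) (hb : Bornology.IsBounded E)
    (hpos : 0 < volume E) (x : Point d) :
    ∫⁻ y in E, ENNReal.ofReal (gaussDensity x S y * (gaussMass E x S)⁻¹) = 1 := by
  rw [← ofReal_integral_eq_lintegral_ofReal ((integrableOn_gaussDensity hS hb x).mul_const _)
    (Eventually.of_forall fun y => mul_nonneg (gaussDensity_pos hS x y).le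
      (inv_nonneg.2 (gaussMass_pos hS hb hpos x).le)), integral_mul_const]
  rw [← gaussMass, mul_inv_cancel₀ (gaussMass_pos hS hb hpos x).ne', ENNReal.ofReal_one]

/-- The prefactor of the density also bounds the mass of `E`, up to vol(E), so it cancels in the
quotient. What remains is the exponential, and on a bounded set the quadratic form of (tΣ)⁻¹ is at
most `τmin⁻¹ * M`, uniformly in `t ≥ τmin`. -/
theorem exists_pos_le_gaussDensity_div {Sg : Matrix (Fin d) (Fin d) ℝ} (hSg : Sg.PosDef)
    (hb : Bornology.IsBounded E) (hpos : 0 < volume E) {τmin : ℝ} (hτ : 0 < τmin) :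
    ∃ c : ℝ, 0 < c ∧ ∀ t, τmin ≤ t → ∀ x ∈ E, ∀ y ∈ E,
      c ≤ gaussDensity x (t • Sg) y * (gaussMass E x (t • Sg))⁻¹ := by
  obtain ⟨M, hM⟩ : ∃ M, ∀ x ∈ E, ∀ y ∈ E, (y - x).ofLp ⬝ᵥ (Sg⁻¹).mulVec (y - x).ofLp ≤ M := by
    have hc : Continuous fun p : Point d × Point d =>
        (p.2 - p.1).ofLp ⬝ᵥ (Sg⁻¹).mulVec (p.2 - p.1).ofLp := by
      have h : Continuous fun p : Point d × Point d => (p.2 - p.1).ofLp :=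
        (PiLp.continuous_ofLp 2 _).comp (continuous_snd.sub continuous_fst)
      exact h.dotProduct (continuous_const.matrix_mulVec h)
    obtain ⟨M, hM⟩ := (hb.isCompact_closure.prod hb.isCompact_closure).bddAbove_image
      hc.continuousOn
    exact ⟨M, fun x hx y hy => hM ⟨(x, y), ⟨subset_closure hx, subset_closure hy⟩, rfl⟩⟩
  have hvol : 0 < volume.real E := ENNReal.toReal_pos hpos.ne' hb.measure_lt_top.ne
  refine ⟨Real.exp (-(1 / 2) * (τmin⁻¹ * M)) / volume.real E, by positivity,
    fun t ht x hx y hy => ?_⟩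
  have ht0 : 0 < t := hτ.trans_le ht
  have hS : (t • Sg).PosDef := hSg.smul ht0
  have hinv : (t • Sg)⁻¹ = t⁻¹ • Sg⁻¹ := by
    have hu : IsUnit Sg.det := hSg.det_pos.ne'.isUnit
    refine Matrix.inv_eq_left_inv ?_
    rw [Matrix.smul_mul, Matrix.mul_smul, smul_smul, inv_mul_cancel₀ ht0.ne', one_smul,
      Matrix.nonsing_inv_mul _ hu]
  rw [← div_eq_mul_inv, div_le_div_iff₀ hvol (gaussMass_pos hS hb hpos x)]
  have hk := gaussDensity_factor_pos hS
  have hQ : (y - x).ofLp ⬝ᵥ ((t • Sg)⁻¹).mulVec (y - x).ofLp ≤ τmin⁻¹ * M := by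
    rw [hinv, Matrix.smul_mulVec, dotProduct_smul, smul_eq_mul]
    have h0 := quadForm_inv_nonneg hSg (y - x).ofLp
    exact mul_le_mul (inv_anti₀ hτ ht) (hM x hx y hy) h0 (by positivity)
  calc _ ≤ Real.exp (-(1 / 2) * (τmin⁻¹ * M)) *
        ((Real.sqrt ((2 * Real.pi) ^ d * (t • Sg).det))⁻¹ * volume.real E) :=
        mul_le_mul_of_nonneg_left (gaussMass_le hS hb x) (Real.exp_pos _).le
    _ = (Real.sqrt ((2 * Real.pi) ^ d * (t • Sg).det))⁻¹ *
        Real.exp (-(1 / 2) * (τmin⁻¹ * M)) * volume.real E := by ring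
    _ ≤ _ := by
      unfold gaussDensity
      gcongr ?_ * ?_ * _
      exact Real.exp_le_exp.2 (by linarith)

/-! ### The selection of an index -/

/-- Probability that the point of index `i` is the one that is moved. -/
def selectProb (γ : ℝ) (i : Fin N) (X : Design N d) : ℝ :=
  ∑ j : Fin N with j ≠ i, 1 / 2 * pairProb γ X i j

theorem pairWeight_pos (hγ : 0 < γ) (X : Design N d) (i j : Fin N) : 0 < pairWeight γ X i j :=
  one_div_pos.2 (add_pos_of_nonneg_of_pos dist_nonneg hγ)

theorem pairWeight_comm (γ : ℝ) (X : Design N d) (i j : Fin N) :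
    pairWeight γ X i j = pairWeight γ X j i := by
  rw [pairWeight, pairWeight, dist_comm]

theorem totalWeight_pos (hN : 2 ≤ N) (hγ : 0 < γ) (X : Design N d) : 0 < totalWeight γ X :=
  Finset.sum_pos (fun p _ => pairWeight_pos hγ X _ _)
    ⟨(⟨0, by omega⟩, ⟨1, by omega⟩), by simp⟩

theorem pairProb_pos (hN : 2 ≤ N) (hγ : 0 < γ) (X : Design N d) (i j : Fin N) :
    0 < pairProb γ X i j :=
  div_pos (pairWeight_pos hγ X i j) (totalWeight_pos hN hγ X)

theorem exists_ne_of_two_le (hN : 2 ≤ N) (i : Fin N) : ∃ j, j ≠ i :=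
  have : Nontrivial (Fin N) := Fin.nontrivial_iff_two_le.2 hN
  exists_ne i

theorem selectProb_pos (hN : 2 ≤ N) (hγ : 0 < γ) (i : Fin N) (X : Design N d) :
    0 < selectProb γ i X := by
  obtain ⟨j, hj⟩ := exists_ne_of_two_le hN i
  exact Finset.sum_pos (fun j _ => mul_pos one_half_pos (pairProb_pos hN hγ X i j))
    ⟨j, by simpa using hj⟩

/-- The ordered sum counts each unordered pair twice, which cancels the factor 1/2. -/
theorem sum_selectProb (hN : 2 ≤ N) (hγ : 0 < γ) (X : Design N d) :
    ∑ i, selectProb γ i X = 1 := by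
  have hT := totalWeight_pos hN hγ X
  have h1 : ∑ i : Fin N, ∑ j : Fin N with j ≠ i, pairWeight γ X i j = 2 * totalWeight γ X := by
    have h2 : ∑ i : Fin N, ∑ j : Fin N with j < i, pairWeight γ X i j = totalWeight γ X := by
      rw [totalWeight, Finset.sum_filter, Fintype.sum_prod_type, Finset.sum_comm]
      refine Finset.sum_congr rfl fun i _ => ?_
      rw [Finset.sum_filter]
      exact Finset.sum_congr rfl fun j _ => by rw [pairWeight_comm]
    have h3 : ∑ i : Fin N, ∑ j : Fin N with i < j, pairWeight γ X i j = totalWeight γ X := by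
      rw [totalWeight, Finset.sum_filter, Fintype.sum_prod_type]
      exact Finset.sum_congr rfl fun i _ => Finset.sum_filter _ _
    rw [two_mul]
    nth_rewrite 1 [← h2]
    rw [← h3, ← Finset.sum_add_distrib]
    refine Finset.sum_congr rfl fun i _ => ?_
    simp only [Finset.sum_filter, ← Finset.sum_add_distrib]
    refine Finset.sum_congr rfl fun j _ => ?_
    rcases lt_trichotomy i j with h | h | h
    · simp [h, h.ne', h.not_gt]
    · simp [h]
    · simp [h, h.ne, h.not_gt]
  simp only [selectProb, pairProb, ← Finset.mul_sum, ← Finset.sum_div]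
  rw [h1]
  field_simp

theorem exists_pos_le_selectProb (hN : 2 ≤ N) (hγ : 0 < γ) (hb : Bornology.IsBounded E) :
    ∃ c : ℝ, 0 < c ∧ ∀ i, ∀ X ∈ designs N E, c ≤ selectProb γ i X := by
  have hD : 0 ≤ Metric.diam E := Metric.diam_nonneg
  have hN0 : 0 < (N : ℝ) := by exact_mod_cast (by omega : 0 < N)
  -- On `E` a weight is at least 1/(diam(E)+γ), and the total is at most N² terms of size 1/γ; one
  -- partner `j` already gives the bound.
  refine ⟨1 / 2 * (1 / (Metric.diam E + γ) / (N * N * (1 / γ))), by positivity,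
    fun i X hX => ?_⟩
  obtain ⟨j, hj⟩ := exists_ne_of_two_le hN i
  have h1 : totalWeight γ X ≤ N * N * (1 / γ) := by
    have hle : ∀ p ∈ (Finset.univ.filter fun p : Fin N × Fin N => p.1 < p.2),
        pairWeight γ X p.1 p.2 ≤ 1 / γ := fun p _ =>
      one_div_le_one_div_of_le hγ (le_add_of_nonneg_left dist_nonneg)
    refine (Finset.sum_le_card_nsmul _ _ _ hle).trans ?_
    rw [nsmul_eq_mul]
    refine mul_le_mul_of_nonneg_right ?_ (by positivity)
    refine (Nat.cast_le.2 (Finset.card_filter_le _ _)).trans ?_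
    simp
  have h2 : 1 / (Metric.diam E + γ) ≤ pairWeight γ X i j :=
    one_div_le_one_div_of_le (add_pos_of_nonneg_of_pos dist_nonneg hγ)
      (add_le_add_left (Metric.dist_le_diam_of_mem hb (hX i) (hX j)) γ)
  have h3 : 1 / 2 * (1 / (Metric.diam E + γ) / (N * N * (1 / γ))) ≤ 1 / 2 * pairProb γ X i j :=
    mul_le_mul_of_nonneg_left (div_le_div₀ (pairWeight_pos hγ X i j).le h2
      (totalWeight_pos hN hγ X) h1) one_half_pos.le
  refine h3.trans (Finset.single_le_sum
    (f := fun j => 1 / 2 * pairProb γ X i j)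
    (fun k _ => (mul_pos one_half_pos (pairProb_pos hN hγ X i k)).le) ?_)
  simpa using hj

end

section

variable {N d : ℕ} {E : Set (Point d)} {S : Matrix (Fin d) (Fin d) ℝ} {γ β : ℝ}

/-! ### The transition kernel -/

theorem proposalDensity_update (i : Fin N) (X : Design N d) (y : Point d) :
    proposalDensity E S γ i X (Function.update X i y) =
      gaussDensity (X i) S y * (gaussMass E (X i) S)⁻¹ * selectProb γ i X := by
  simp [proposalDensity, selectProb]

theorem proposalDensity_pos (hN : 2 ≤ N) (hγ : 0 < γ) (hS : S.PosDef)
    (hb : Bornology.IsBounded E) (hpos : 0 < volume E) (i : Fin N) (X Y : Design N d) :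
    0 < proposalDensity E S γ i X Y :=
  mul_pos (mul_pos (gaussDensity_pos hS _ _) (inv_pos.2 (gaussMass_pos hS hb hpos _)))
    (selectProb_pos hN hγ i X)

theorem acceptProb_nonneg (hN : 2 ≤ N) (hγ : 0 < γ) (hS : S.PosDef)
    (hb : Bornology.IsBounded E) (hpos : 0 < volume E) (i : Fin N) (X Y : Design N d) :
    0 ≤ acceptProb E S γ β i X Y :=
  le_min zero_le_one (mul_nonneg (Real.exp_pos _).le
    (div_pos (proposalDensity_pos hN hγ hS hb hpos i Y X)
      (proposalDensity_pos hN hγ hS hb hpos i X Y)).le)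

theorem acceptProb_le_one (i : Fin N) (X Y : Design N d) : acceptProb E S γ β i X Y ≤ 1 :=
  min_le_left _ _

theorem acceptLaw_univ (hN : 2 ≤ N) (hγ : 0 < γ) (hS : S.PosDef)
    (hb : Bornology.IsBounded E) (hpos : 0 < volume E) (i : Fin N) (X Y : Design N d) :
    acceptLaw E S γ β i X Y Set.univ = 1 := by
  simp only [acceptLaw, Measure.add_apply, Measure.smul_apply, measure_univ, smul_eq_mul, mul_one]
  rw [← ENNReal.ofReal_add (acceptProb_nonneg hN hγ hS hb hpos i X Y)
    (sub_nonneg.2 (acceptProb_le_one i X Y)), add_sub_cancel, ENNReal.ofReal_one]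

theorem acceptLaw_apply (i : Fin N) (X Y : Design N d) {A : Set (Design N d)}
    (hA : MeasurableSet A) :
    acceptLaw E S γ β i X Y A = ENNReal.ofReal (acceptProb E S γ β i X Y) * A.indicator 1 Y +
      ENNReal.ofReal (1 - acceptProb E S γ β i X Y) * A.indicator 1 X := by
  simp [acceptLaw, Measure.dirac_apply' _ hA]

/-- The partner `j` influences only the choice of `i`, so summing over it turns selection and
Gaussian draw into the single density occurring in the acceptance ratio. -/
theorem stepLaw_apply (hN : 2 ≤ N) (hγ : 0 < γ) (X : Design N d) {A : Set (Design N d)}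
    (hA : MeasurableSet A) :
    stepLaw E S γ β X A = ∑ i, ∫⁻ y in E,
      ENNReal.ofReal (proposalDensity E S γ i X (Function.update X i y)) *
        acceptLaw E S γ β i X (Function.update X i y) A := by
  simp only [stepLaw, Measure.finsetSum_apply, Measure.smul_apply, smul_eq_mul]
  refine Finset.sum_congr rfl fun i _ => ?_
  have hm := (measurable_acceptLaw_update (N := N) E S γ β i).comp
    (measurable_prodMk_left (x := X))
  have hbind : (truncGauss E (X i) S).bind
      (fun y => acceptLaw E S γ β i X (Function.update X i y)) A =
      ∫⁻ y in E, ENNReal.ofReal (gaussDensity (X i) S y / gaussMass E (X i) S) *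
        acceptLaw E S γ β i X (Function.update X i y) A :=
    bind_truncGauss_apply E S (X i) hm hA
  rw [← Finset.sum_mul, ← ENNReal.ofReal_sum_of_nonneg fun j _ =>
      (mul_pos one_half_pos (pairProb_pos hN hγ X i j)).le, hbind,
    ← lintegral_const_mul' _ _ ENNReal.ofReal_ne_top]
  refine lintegral_congr fun y => ?_
  rw [← mul_assoc, ← ENNReal.ofReal_mul (Finset.sum_nonneg fun j _ =>
    (mul_pos one_half_pos (pairProb_pos hN hγ X i j)).le), proposalDensity_update,
    mul_comm _ (selectProb γ i X), div_eq_mul_inv (gaussDensity (X i) S y), selectProb]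

theorem lintegral_proposalDensity (hN : 2 ≤ N) (hγ : 0 < γ) (hS : S.PosDef)
    (hb : Bornology.IsBounded E) (hpos : 0 < volume E) (i : Fin N) (X : Design N d) :
    ∫⁻ y in E, ENNReal.ofReal (proposalDensity E S γ i X (Function.update X i y)) =
      ENNReal.ofReal (selectProb γ i X) := by
  simp only [proposalDensity_update, ENNReal.ofReal_mul' (selectProb_pos hN hγ i X).le]
  rw [lintegral_mul_const' _ _ ENNReal.ofReal_ne_top, lintegral_gaussDensity_div hS hb hpos,
    one_mul]

theorem sum_ofReal_selectProb (hN : 2 ≤ N) (hγ : 0 < γ) (X : Design N d) :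
    ∑ i, ENNReal.ofReal (selectProb γ i X) = 1 := by
  rw [← ENNReal.ofReal_sum_of_nonneg fun i _ => (selectProb_pos hN hγ i X).le,
    sum_selectProb hN hγ, ENNReal.ofReal_one]

theorem isMarkovKernel_stepKernel (hN : 2 ≤ N) (hγ : 0 < γ) (hS : S.PosDef)
    (hb : Bornology.IsBounded E) (hpos : 0 < volume E) :
    IsMarkovKernel (stepKernel E S γ β : Kernel (Design N d) (Design N d)) := by
  refine ⟨fun X => ⟨?_⟩⟩
  change stepLaw E S γ β X Set.univ = 1
  rw [stepLaw_apply hN hγ X MeasurableSet.univ]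
  simp only [acceptLaw_univ hN hγ hS hb hpos, mul_one, lintegral_proposalDensity hN hγ hS hb hpos]
  exact sum_ofReal_selectProb hN hγ X

theorem stepLaw_compl_designs (hN : 2 ≤ N) (hγ : 0 < γ) (hE : MeasurableSet E)
    {X : Design N d} (hX : X ∈ designs N E) : stepLaw E S γ β X (designs N E)ᶜ = 0 := by
  rw [stepLaw_apply hN hγ X (measurableSet_designs hE).compl]
  refine Finset.sum_eq_zero fun i _ => ?_
  rw [setLIntegral_congr_fun hE (g := fun _ => 0), lintegral_zero]
  intro y hy
  simp [acceptLaw_apply _ _ _ (measurableSet_designs hE).compl, hX, update_mem_designs hX i hy]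

theorem ae_mem_designs_bind (hN : 2 ≤ N) (hγ : 0 < γ) (hE : MeasurableSet E)
    {ρ : Measure (Design N d)} (hρ : ∀ᵐ X ∂ρ, X ∈ designs N E) :
    ∀ᵐ X ∂ρ.bind (stepKernel E S γ β), X ∈ designs N E := by
  rw [ae_iff]
  change (ρ.bind (stepKernel E S γ β)) (designs N E)ᶜ = 0
  rw [Measure.bind_apply (measurableSet_designs hE).compl
    (stepKernel E S γ β).measurable.aemeasurable]
  refine (lintegral_congr_ae (g := fun _ => 0) ?_).trans lintegral_zero
  filter_upwards [hρ] with X hX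
  exact stepLaw_compl_designs hN hγ hE hX

/-! ### Reversibility -/

/-- The unnormalized Gibbs measure at inverse temperature `β`. -/
def gibbs (N : ℕ) (E : Set (Point d)) (β : ℝ) : Measure (Design N d) :=
  (lebN N E).withDensity fun X => ENNReal.ofReal (Real.exp (-β * U E X))

theorem measurable_gibbsDensity (E : Set (Point d)) (β : ℝ) :
    Measurable fun X : Design N d => ENNReal.ofReal (Real.exp (-β * U E X)) :=
  (Real.measurable_exp.comp ((measurable_U E).const_mul (-β))).ennreal_ofReal

/-- The density of accepted moves of the point of index `i` in stationarity. -/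
def flux (E : Set (Point d)) (S : Matrix (Fin d) (Fin d) ℝ) (γ β : ℝ) (i : Fin N)
    (X Y : Design N d) : ℝ :=
  min (Real.exp (-β * U E X) * proposalDensity E S γ i X Y)
    (Real.exp (-β * U E Y) * proposalDensity E S γ i Y X)

theorem flux_comm (i : Fin N) (X Y : Design N d) : flux E S γ β i X Y = flux E S γ β i Y X :=
  min_comm _ _

theorem measurable_flux (E : Set (Point d)) (S : Matrix (Fin d) (Fin d) ℝ) (γ β : ℝ)
    (i : Fin N) : Measurable fun p : Design N d × Design N d => flux E S γ β i p.1 p.2 := by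
  have hq := measurable_proposalDensity (N := N) E S γ i
  have hw : Measurable fun X : Design N d => Real.exp (-β * U E X) :=
    Real.measurable_exp.comp ((measurable_U E).const_mul (-β))
  have hq' := hq.comp measurable_swap
  have hw₁ : Measurable fun p : Design N d × Design N d => Real.exp (-β * U E p.1) :=
    hw.comp measurable_fst
  have hw₂ : Measurable fun p : Design N d × Design N d => Real.exp (-β * U E p.2) :=
    hw.comp measurable_snd
  simp only [Function.comp_def, Prod.fst_swap, Prod.snd_swap] at hq'
  exact (hw₁.mul hq).min (hw₂.mul hq')

theorem proposalDensity_mul_acceptProb (hN : 2 ≤ N) (hγ : 0 < γ) (hS : S.PosDef)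
    (hb : Bornology.IsBounded E) (hpos : 0 < volume E) (i : Fin N) (X Y : Design N d) :
    proposalDensity E S γ i X Y * acceptProb E S γ β i X Y =
      min (proposalDensity E S γ i X Y)
        (Real.exp (-β * (U E Y - U E X)) * proposalDensity E S γ i Y X) := by
  have h := proposalDensity_pos hN hγ hS hb hpos i X Y
  rw [acceptProb, mul_min_of_nonneg _ _ h.le, mul_one, mul_left_comm, mul_div_cancel₀ _ h.ne']

/-- Detailed balance: multiplying the minimum by the Gibbs weight and the proposal density yields an
expression symmetric in `X` and `Y`. -/
theorem exp_mul_proposalDensity_mul_acceptProb (hN : 2 ≤ N) (hγ : 0 < γ) (hS : S.PosDef)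
    (hb : Bornology.IsBounded E) (hpos : 0 < volume E) (i : Fin N) (X Y : Design N d) :
    Real.exp (-β * U E X) * (proposalDensity E S γ i X Y * acceptProb E S γ β i X Y) =
      flux E S γ β i X Y := by
  rw [proposalDensity_mul_acceptProb hN hγ hS hb hpos, mul_min_of_nonneg _ _ (Real.exp_pos _).le,
    ← mul_assoc, ← Real.exp_add, flux]
  ring_nf

/-- Accepted moves are tested at the arrival point, rejected ones at the departure point. Symmetry
of the flux moves the first test to the departure point, where both parts recombine into the full
proposal, of total mass 1. -/
theorem gibbs_bind_stepKernel (hN : 2 ≤ N) (hγ : 0 < γ) (hS : S.PosDef)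
    (hb : Bornology.IsBounded E) (hpos : 0 < volume E) :
    (gibbs N E β).bind (stepKernel E S γ β) = gibbs N E β := by
  have : IsFiniteMeasure (volume.restrict E) := ⟨by simpa using hb.measure_lt_top⟩
  ext A hA
  have hw := measurable_gibbsDensity (N := N) E β
  have h1A : Measurable (A.indicator 1 : Design N d → ℝ≥0∞) := measurable_one.indicator hA
  rw [Measure.bind_apply hA (stepKernel E S γ β).measurable.aemeasurable, gibbs,
    lintegral_withDensity_eq_lintegral_mul _ hw (Kernel.measurable_coe _ hA),
    withDensity_apply _ hA]
  set w : Design N d → ℝ≥0∞ := fun X => ENNReal.ofReal (Real.exp (-β * U E X)) with hw_def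
  -- The rejected flow, which stays at `X`.
  let g : Fin N → Design N d → Design N d → ℝ≥0∞ := fun i X Y => ENNReal.ofReal
    (Real.exp (-β * U E X) *
      (proposalDensity E S γ i X Y * (1 - acceptProb E S γ β i X Y))) * A.indicator 1 X
  have hfl := fun i => (measurable_flux (N := N) E S γ β i).ennreal_ofReal
  have hgm : ∀ i, Measurable fun p : Design N d × Design N d => g i p.1 p.2 := by
    intro i
    refine Measurable.mul (Measurable.ennreal_ofReal (Measurable.mul ?_ ?_))
      (h1A.comp measurable_fst)
    · exact Real.measurable_exp.comp (((measurable_U E).comp measurable_fst).const_mul (-β))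
    · exact (measurable_proposalDensity E S γ i).mul
        (measurable_const.sub (measurable_acceptProb E S γ β i))
  have hsplit : ∀ i (X Y : Design N d), w X * (ENNReal.ofReal (proposalDensity E S γ i X Y) *
      acceptLaw E S γ β i X Y A) =
      ENNReal.ofReal (flux E S γ β i X Y) * A.indicator 1 Y + g i X Y := by
    intro i X Y
    have hq := (proposalDensity_pos hN hγ hS hb hpos i X Y).le
    rw [acceptLaw_apply _ _ _ hA, ← exp_mul_proposalDensity_mul_acceptProb hN hγ hS hb hpos]
    simp only [g, hw_def, ENNReal.ofReal_mul (Real.exp_pos _).le, ENNReal.ofReal_mul hq]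
    ring
  -- After the exchange the acceptance probability disappears: α + (1 - α) = 1.
  have hjoin : ∀ i (X Y : Design N d),
      ENNReal.ofReal (flux E S γ β i X Y) * A.indicator 1 X + g i X Y =
      w X * A.indicator 1 X * ENNReal.ofReal (proposalDensity E S γ i X Y) := by
    intro i X Y
    have hq := (proposalDensity_pos hN hγ hS hb hpos i X Y).le
    have ha := acceptProb_nonneg (β := β) hN hγ hS hb hpos i X Y
    have ha' := sub_nonneg.2 (acceptProb_le_one (E := E) (S := S) (γ := γ) (β := β) i X Y)
    rw [← exp_mul_proposalDensity_mul_acceptProb hN hγ hS hb hpos, ← add_mul,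
      ← ENNReal.ofReal_add (mul_nonneg (Real.exp_pos _).le (mul_nonneg hq ha))
        (mul_nonneg (Real.exp_pos _).le (mul_nonneg hq ha')), ← mul_add, ← mul_add,
      add_sub_cancel, mul_one, ENNReal.ofReal_mul (Real.exp_pos _).le]
    ring
  have hterm : ∀ i : Fin N, ∫⁻ X, (∫⁻ y in E, w X *
      (ENNReal.ofReal (proposalDensity E S γ i X (Function.update X i y)) *
        acceptLaw E S γ β i X (Function.update X i y) A)) ∂lebN N E =
      ∫⁻ X, w X * A.indicator 1 X * ENNReal.ofReal (selectProb γ i X) ∂lebN N E := by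
    intro i
    simp only [hsplit]
    rw [lebN_eq_pi]
    refine (lintegral_pi_update_symm (fun _ : Fin N => volume.restrict E) i
      (F := fun X Y => ENNReal.ofReal (flux E S γ β i X Y)) (G := g i) (hfl i) (hgm i) h1A
      fun X Y => by rw [flux_comm]).trans ?_
    refine lintegral_congr fun X => ?_
    simp only [hjoin]
    rw [lintegral_const_mul' _ _ ?_, lintegral_proposalDensity hN hγ hS hb hpos i X]
    refine ENNReal.mul_ne_top ENNReal.ofReal_ne_top ?_
    by_cases hX : X ∈ A <;> simp [hX]
  have hstep : ∀ X, w X * stepKernel E S γ β X A = ∑ i, ∫⁻ y in E, w X *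
      (ENNReal.ofReal (proposalDensity E S γ i X (Function.update X i y)) *
        acceptLaw E S γ β i X (Function.update X i y) A) := by
    intro X
    change w X * stepLaw E S γ β X A = _
    rw [stepLaw_apply hN hγ X hA, Finset.mul_sum]
    exact Finset.sum_congr rfl fun i _ =>
      (lintegral_const_mul' _ _ ENNReal.ofReal_ne_top).symm
  have hmeas : ∀ i : Fin N, Measurable fun X : Design N d => ∫⁻ y in E, w X *
      (ENNReal.ofReal (proposalDensity E S γ i X (Function.update X i y)) *
        acceptLaw E S γ β i X (Function.update X i y) A) := by
    intro i
    simp only [hsplit]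
    have hm : Measurable fun p : Design N d × Design N d =>
        ENNReal.ofReal (flux E S γ β i p.1 p.2) * A.indicator 1 p.2 + g i p.1 p.2 :=
      ((hfl i).mul (h1A.comp measurable_snd)).add (hgm i)
    have hm' := (hm.comp (measurable_prodMk_update i)).lintegral_prod_right'
      (ν := volume.restrict E)
    simp only [Function.comp_def] at hm'
    exact hm'
  calc ∫⁻ X, (w * fun X => stepKernel E S γ β X A) X ∂lebN N E
      = ∑ i, ∫⁻ X, w X * A.indicator 1 X * ENNReal.ofReal (selectProb γ i X) ∂lebN N E := by
        simp only [Pi.mul_apply, hstep]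
        rw [lintegral_finsetSum _ fun i _ => hmeas i]
        exact Finset.sum_congr rfl fun i _ => hterm i
    _ = ∫⁻ X, w X * A.indicator 1 X ∂lebN N E := by
        rw [← lintegral_finsetSum]
        · simp only [← Finset.mul_sum, sum_ofReal_selectProb hN hγ, mul_one]
        · intro i _
          refine (hw.mul h1A).mul (Measurable.ennreal_ofReal ?_)
          exact Finset.measurable_sum _ fun j _ =>
            (measurable_pairProb γ i j).const_mul (1 / 2)
    _ = ∫⁻ X in A, w X ∂lebN N E := by
        rw [← lintegral_indicator hA]
        refine lintegral_congr fun X => ?_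
        by_cases hX : X ∈ A <;> simp [hX]

/-! ### Minorization -/

/-- Only accepted moves of the point `i` are kept. Their density is min(q(X,Y), exp(-βΔU) q(Y,X));
bounding `q` below in both directions and ΔU by the oscillation makes the bound independent of `X`.
-/
theorem resample_le_bind_stepKernel (hN : 2 ≤ N) (hγ : 0 < γ) (hS : S.PosDef)
    (hb : Bornology.IsBounded E) (hE : MeasurableSet E) (hpos : 0 < volume E) (hβ : 0 ≤ β)
    {c : ℝ} (hc0 : 0 ≤ c)
    (hc : ∀ i, ∀ X ∈ designs N E, ∀ Y ∈ designs N E, c ≤ proposalDensity E S γ i X Y)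
    {ρ : Measure (Design N d)} (hρ : ∀ᵐ X ∂ρ, X ∈ designs N E) (i : Fin N)
    {f : Design N d → ℝ≥0∞} (hf : Measurable f) :
    ENNReal.ofReal (c * Real.exp (-β * osc N E)) *
        ∫⁻ X, (∫⁻ y in E, f (Function.update X i y)) ∂ρ ≤
      ∫⁻ X, f X ∂ρ.bind (stepKernel E S γ β) := by
  rw [Measure.lintegral_bind (stepKernel E S γ β).measurable.aemeasurable hf.aemeasurable,
    ← lintegral_const_mul' _ _ ENNReal.ofReal_ne_top]
  refine lintegral_mono_ae ?_
  filter_upwards [hρ] with X hX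
  have hu : Measurable fun y : Point d => Function.update X i y :=
    (measurable_snd.comp (measurable_update_pair i)).comp (measurable_prodMk_left (x := X))
  have hle : ENNReal.ofReal (c * Real.exp (-β * osc N E)) •
      (volume.restrict E).map (fun y => Function.update X i y) ≤ stepKernel E S γ β X := by
    refine Measure.le_iff.2 fun A hA => ?_
    change _ ≤ stepLaw E S γ β X A
    rw [Measure.smul_apply, smul_eq_mul, ← lintegral_indicator_one hA,
      lintegral_map (measurable_one.indicator hA) hu,
      ← lintegral_const_mul' _ _ ENNReal.ofReal_ne_top, stepLaw_apply hN hγ X hA]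
    refine le_trans ?_ (Finset.single_le_sum (fun _ _ => zero_le) (Finset.mem_univ i))
    refine setLIntegral_mono' hE fun y hy => ?_
    have hY := update_mem_designs hX i hy
    rw [acceptLaw_apply _ _ _ hA, mul_add, ← mul_assoc,
      ← ENNReal.ofReal_mul (proposalDensity_pos hN hγ hS hb hpos _ _ _).le,
      proposalDensity_mul_acceptProb hN hγ hS hb hpos]
    refine le_trans (mul_le_mul_left (ENNReal.ofReal_le_ofReal (le_min ?_ ?_)) _) le_self_add
    · refine (mul_le_of_le_one_right hc0 (Real.exp_le_one_iff.2 ?_)).trans (hc i _ hX _ hY)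
      have := mul_nonneg hβ (osc_nonneg N E)
      linarith
    · rw [mul_comm]
      refine mul_le_mul (Real.exp_le_exp.2 ?_) (hc i _ hY _ hX) hc0 (Real.exp_pos _).le
      have := mul_le_mul_of_nonneg_left (U_sub_le_osc hN hb hX hY) hβ
      linarith
  calc _ = ∫⁻ Y, f Y ∂(ENNReal.ofReal (c * Real.exp (-β * osc N E)) •
        (volume.restrict E).map (fun y => Function.update X i y)) := by
        rw [lintegral_smul_measure, lintegral_map hf hu, smul_eq_mul]
    _ ≤ _ := lintegral_mono' hle le_rfl

theorem exists_pos_le_proposalDensity (hN : 2 ≤ N) (hγ : 0 < γ)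
    {Sg : Matrix (Fin d) (Fin d) ℝ} (hSg : Sg.PosDef)
    (hb : Bornology.IsBounded E) (hpos : 0 < volume E) {τmin : ℝ} (hτ : 0 < τmin) :
    ∃ c : ℝ, 0 < c ∧ ∀ t, τmin ≤ t → ∀ i, ∀ X ∈ designs N E, ∀ Y ∈ designs N E,
      c ≤ proposalDensity E (t • Sg) γ i X Y := by
  obtain ⟨c₁, h₁, hc₁⟩ := exists_pos_le_gaussDensity_div hSg hb hpos hτ
  obtain ⟨c₂, h₂, hc₂⟩ := exists_pos_le_selectProb hN hγ hb
  refine ⟨c₁ * c₂, mul_pos h₁ h₂, fun t ht i X hX Y hY => ?_⟩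
  have h := hc₁ t ht (X i) (hX i) (Y i) (hY i)
  exact mul_le_mul h (hc₂ i X hX) h₂.le (h₁.le.trans h)

end

section

variable {N d : ℕ} {E : Set (Point d)} {S : Matrix (Fin d) (Fin d) ℝ} {γ β : ℝ}

/-! ### The Gibbs measures -/

theorem ae_lebN_mem_designs (hE : MeasurableSet E) : ∀ᵐ X ∂lebN N E, X ∈ designs N E :=
  ae_restrict_mem (measurableSet_designs hE)

theorem gibbs_le_smul_lebN {a : ℝ} (hβ : 0 ≤ β) (ha : ∀ᵐ X ∂lebN N E, a ≤ U E X) :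
    gibbs N E β ≤ ENNReal.ofReal (Real.exp (-β * a)) • lebN N E := by
  rw [← withDensity_const]
  refine withDensity_mono ?_
  filter_upwards [ha] with X hX
  refine ENNReal.ofReal_le_ofReal (Real.exp_le_exp.2 ?_)
  have := mul_le_mul_of_nonneg_left hX hβ
  linarith

theorem isFiniteMeasure_gibbs (hN : 2 ≤ N) (hb : Bornology.IsBounded E) (hE : MeasurableSet E)
    (hβ : 0 ≤ β) : IsFiniteMeasure (gibbs N E β) := by
  have := isFiniteMeasure_lebN (N := N) hb
  have h := gibbs_le_smul_lebN (a := 0) hβ <| by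
    filter_upwards [ae_lebN_mem_designs (N := N) hE] with X hX using U_nonneg hN hb hX
  refine ⟨(h Set.univ).trans_lt ?_⟩
  rw [Measure.smul_apply, smul_eq_mul]
  exact ENNReal.mul_lt_top ENNReal.ofReal_lt_top (measure_lt_top _ _)

theorem mul_lebN_lt_le_gibbs_univ (hβ : 0 ≤ β) (a : ℝ) :
    ENNReal.ofReal (Real.exp (-β * a)) * lebN N E {X | U E X < a} ≤ gibbs N E β Set.univ := by
  have hm : MeasurableSet {X : Design N d | U E X < a} :=
    measurableSet_lt (measurable_U E) measurable_const
  refine le_trans ?_ (measure_mono (Set.subset_univ {X | U E X < a}))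
  rw [gibbs, withDensity_apply _ hm, ← setLIntegral_const]
  refine setLIntegral_mono' hm fun X hX => ENNReal.ofReal_le_ofReal (Real.exp_le_exp.2 ?_)
  have hX' : U E X < a := hX
  have := mul_le_mul_of_nonneg_left hX'.le hβ
  linarith

theorem gibbs_univ_pos (hpos : 0 < volume E) (hβ : 0 ≤ β) :
    0 < gibbs N E β Set.univ :=
  lt_of_lt_of_le (ENNReal.mul_pos (ENNReal.ofReal_pos.2 (Real.exp_pos _)).ne'
    (lebN_U_lt_pos hpos one_pos).ne') (mul_lebN_lt_le_gibbs_univ hβ (minU N E + 1))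

/-- The Gibbs measure at inverse temperature `β`, the stationary law of the algorithm. -/
def gibbsProb (N : ℕ) (E : Set (Point d)) (β : ℝ) : Measure (Design N d) :=
  (gibbs N E β Set.univ)⁻¹ • gibbs N E β

theorem isProbabilityMeasure_gibbsProb (hN : 2 ≤ N) (hb : Bornology.IsBounded E)
    (hE : MeasurableSet E) (hpos : 0 < volume E) (hβ : 0 ≤ β) :
    IsProbabilityMeasure (gibbsProb N E β) := by
  have := isFiniteMeasure_gibbs hN hb hE hβ
  refine ⟨?_⟩
  rw [gibbsProb, Measure.smul_apply, smul_eq_mul]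
  exact ENNReal.inv_mul_cancel (gibbs_univ_pos hpos hβ).ne' (measure_ne_top _ _)

theorem gibbsProb_bind_stepKernel (hN : 2 ≤ N) (hγ : 0 < γ) (hS : S.PosDef)
    (hb : Bornology.IsBounded E) (hpos : 0 < volume E) :
    (gibbsProb N E β).bind (stepKernel E S γ β) = gibbsProb N E β := by
  rw [gibbsProb, Measure.comp_smul, gibbs_bind_stepKernel hN hγ hS hb hpos]

/-- Since U ≥ 0 on E^N, raising β lowers the unnormalized density; since U ≤ diam(E), the partition
function shrinks by no more than the stated factor. -/
theorem smul_gibbsProb_le_gibbsProb (hN : 2 ≤ N) (hb : Bornology.IsBounded E)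
    (hE : MeasurableSet E) {β' : ℝ} (hβ : 0 ≤ β) (hβ' : β ≤ β') :
    ENNReal.ofReal (Real.exp (-((β' - β) * Metric.diam E))) • gibbsProb N E β' ≤
      gibbsProb N E β := by
  have := isFiniteMeasure_gibbs hN hb hE hβ
  have := isFiniteMeasure_gibbs hN hb hE (hβ.trans hβ')
  have hmem := ae_lebN_mem_designs (N := N) hE
  have h1 : gibbs N E β' ≤ gibbs N E β := by
    refine withDensity_mono ?_
    filter_upwards [hmem] with X hX
    refine ENNReal.ofReal_le_ofReal (Real.exp_le_exp.2 ?_)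
    have := mul_le_mul_of_nonneg_right hβ' (U_nonneg hN hb hX)
    linarith
  have h2 : ENNReal.ofReal (Real.exp (-((β' - β) * Metric.diam E))) * gibbs N E β Set.univ ≤
      gibbs N E β' Set.univ := by
    rw [gibbs, gibbs, withDensity_apply _ MeasurableSet.univ, withDensity_apply _ MeasurableSet.univ,
      ← lintegral_const_mul' _ _ ENNReal.ofReal_ne_top]
    refine lintegral_mono fun X => ?_
    rw [← ENNReal.ofReal_mul (Real.exp_pos _).le, ← Real.exp_add]
    refine ENNReal.ofReal_le_ofReal (Real.exp_le_exp.2 ?_)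
    have := mul_le_mul_of_nonneg_left (U_le_diam (E := E) X) (sub_nonneg.2 hβ')
    linarith
  refine Measure.le_iff.2 fun A _ => ?_
  simp only [gibbsProb, Measure.smul_apply, smul_eq_mul]
  rw [← mul_assoc]
  refine mul_le_mul' ?_ (h1 A)
  rw [← div_eq_mul_inv, ENNReal.le_inv_iff_mul_le, ← ENNReal.mul_div_right_comm]
  exact ENNReal.div_le_of_le_mul (by rwa [one_mul])

/-- The Gibbs weight is at most exp(-β(m-ε)) almost everywhere and the partition function at least
exp(-β(m+ε)) times the volume of {U < m+ε}, hence the `2 * ε`. This nearly free comparison keeps the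
final exponent close to N·osc; bounding the density through the oscillation would cost one more osc.
-/
theorem smul_gibbsProb_le_lebN (hN : 2 ≤ N) (hb : Bornology.IsBounded E)
    (hβ : 0 ≤ β) {ε : ℝ} (hε : 0 < ε) :
    ENNReal.ofReal ((lebN N E).real {X | U E X < minU N E + ε} * Real.exp (-β * (2 * ε))) •
      gibbsProb N E β ≤ lebN N E := by
  have := isFiniteMeasure_lebN (N := N) hb
  have h1 := gibbs_le_smul_lebN hβ (ae_minU_sub_le (N := N) hN hb hε)
  have h2 := mul_lebN_lt_le_gibbs_univ (N := N) (E := E) hβ (minU N E + ε)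
  refine Measure.le_iff.2 fun A _ => ?_
  have h3 := h1 A
  simp only [gibbsProb, Measure.smul_apply, smul_eq_mul] at h3 ⊢
  rw [ENNReal.ofReal_mul measureReal_nonneg, ofReal_measureReal]
  calc _ ≤ lebN N E {X | U E X < minU N E + ε} * ENNReal.ofReal (Real.exp (-β * (2 * ε))) *
        ((gibbs N E β Set.univ)⁻¹ *
          (ENNReal.ofReal (Real.exp (-β * (minU N E - ε))) * lebN N E A)) := by gcongr
    _ = ENNReal.ofReal (Real.exp (-β * (2 * ε)) * Real.exp (-β * (minU N E - ε))) *
        lebN N E {X | U E X < minU N E + ε} * (gibbs N E β Set.univ)⁻¹ * lebN N E A := by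
      rw [ENNReal.ofReal_mul (Real.exp_pos _).le]; ring
    _ ≤ 1 * lebN N E A := by
      rw [← Real.exp_add, show -β * (2 * ε) + -β * (minU N E - ε) = -β * (minU N E + ε) by ring]
      gcongr
      rw [← div_eq_mul_inv]
      exact ENNReal.div_le_of_le_mul (by rwa [one_mul])
    _ = _ := one_mul _

theorem measurableSet_nearOptimal (hE : MeasurableSet E) (ε : ℝ) :
    MeasurableSet (nearOptimal N E ε) :=
  (measurableSet_designs hE).inter (measurableSet_le (measurable_U E) measurable_const)

/-- Laplace principle: the mass beyond m+ε is of order exp(-β(m+ε)), while the designs below m+ε/2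
already contribute order exp(-β(m+ε/2)) to the partition function. -/
theorem tendsto_gibbsProb_nearOptimal (hN : 2 ≤ N) (hb : Bornology.IsBounded E)
    (hE : MeasurableSet E) (hpos : 0 < volume E) {ε : ℝ} (hε : 0 < ε) :
    Tendsto (fun β => (gibbsProb N E β).real (nearOptimal N E ε)) atTop (𝓝 1) := by
  have := isFiniteMeasure_lebN (N := N) hb
  set v := (lebN N E).real {X | U E X < minU N E + ε / 2} with hv
  have hv0 : 0 < v :=
    ENNReal.toReal_pos (lebN_U_lt_pos hpos (half_pos hε)).ne' (measure_ne_top _ _)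
  have hlim : Tendsto (fun β => 1 - (lebN N E).real Set.univ / v * Real.exp (-(β * (ε / 2))))
      atTop (𝓝 (1 - (lebN N E).real Set.univ / v * 0)) :=
    tendsto_const_nhds.sub (tendsto_const_nhds.mul (Real.tendsto_exp_neg_atTop_nhds_zero.comp
      (tendsto_id.atTop_mul_const (half_pos hε))))
  rw [mul_zero, sub_zero] at hlim
  have hfin : ∀ᶠ β : ℝ in atTop, 0 ≤ β := eventually_ge_atTop 0
  refine tendsto_of_tendsto_of_tendsto_of_le_of_le' hlim tendsto_const_nhds ?_ ?_
  · filter_upwards [hfin] with β hβ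
    have := isProbabilityMeasure_gibbsProb hN hb hE hpos hβ
    have := isFiniteMeasure_gibbs hN hb hE hβ
    have hB := (measurableSet_nearOptimal (N := N) hE ε).compl
    rw [← compl_compl (nearOptimal N E ε), probReal_compl_eq_one_sub hB]
    refine sub_le_sub_left ?_ 1
    have hZ : Real.exp (-β * (minU N E + ε / 2)) * v ≤ (gibbs N E β).real Set.univ := by
      have h := ENNReal.toReal_mono (measure_ne_top _ _)
        (mul_lebN_lt_le_gibbs_univ (N := N) (E := E) hβ (minU N E + ε / 2))
      rwa [ENNReal.toReal_mul, ENNReal.toReal_ofReal (Real.exp_pos _).le] at h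
    have hA : (gibbs N E β).real (nearOptimal N E ε)ᶜ ≤
        Real.exp (-β * (minU N E + ε)) * (lebN N E).real Set.univ := by
      have h : gibbs N E β (nearOptimal N E ε)ᶜ ≤
          ENNReal.ofReal (Real.exp (-β * (minU N E + ε))) * lebN N E Set.univ := by
        rw [gibbs, withDensity_apply _ hB]
        calc _ ≤ ∫⁻ X in (nearOptimal N E ε)ᶜ,
              ENNReal.ofReal (Real.exp (-β * (minU N E + ε))) ∂lebN N E := by
              refine lintegral_mono_ae ?_
              filter_upwards [ae_restrict_mem hB, ae_restrict_of_ae (ae_lebN_mem_designs hE)]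
                with X hX hX'
              refine ENNReal.ofReal_le_ofReal (Real.exp_le_exp.2 ?_)
              have hlt : minU N E + ε < U E X := by
                by_contra! hle
                exact hX ⟨hX', hle⟩
              have := mul_le_mul_of_nonneg_left hlt.le hβ
              linarith
          _ ≤ _ := by
              rw [setLIntegral_const]
              gcongr
              exact Set.subset_univ _
      have h' := ENNReal.toReal_mono
        (ENNReal.mul_ne_top ENNReal.ofReal_ne_top (measure_ne_top _ _)) h
      rwa [ENNReal.toReal_mul, ENNReal.toReal_ofReal (Real.exp_pos _).le] at h'
    have hZ0 : 0 < (gibbs N E β).real Set.univ := lt_of_lt_of_le (by positivity) hZ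
    have hval : (gibbsProb N E β).real (nearOptimal N E ε)ᶜ =
        (gibbs N E β).real (nearOptimal N E ε)ᶜ / (gibbs N E β).real Set.univ := by
      rw [gibbsProb, measureReal_ennreal_smul_apply, ENNReal.toReal_inv, div_eq_inv_mul]; rfl
    rw [hval, div_le_iff₀ hZ0]
    refine hA.trans ?_
    calc Real.exp (-β * (minU N E + ε)) * (lebN N E).real Set.univ
        = (lebN N E).real Set.univ / v * Real.exp (-(β * (ε / 2))) *
          (Real.exp (-β * (minU N E + ε / 2)) * v) := by
          rw [show -β * (minU N E + ε) = -(β * (ε / 2)) + -β * (minU N E + ε / 2) by ring,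
            Real.exp_add]
          field_simp
      _ ≤ _ := by gcongr
  · filter_upwards [hfin] with β hβ
    have := isProbabilityMeasure_gibbsProb hN hb hE hpos hβ
    exact measureReal_le_one

end

section

variable {N d : ℕ} {E : Set (Point d)} {γ : ℝ}

/-! ### Composition of the steps -/

theorem bind_mono_left {α : Type*} [MeasurableSpace α] {ρ ρ' : Measure α} (h : ρ ≤ ρ')
    (κ : Kernel α α) : ρ.bind κ ≤ ρ'.bind κ := by
  refine Measure.le_iff.2 fun A hA => ?_
  rw [Measure.bind_apply hA κ.measurable.aemeasurable,
    Measure.bind_apply hA κ.measurable.aemeasurable]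
  exact lintegral_mono' h le_rfl

/-- The law after `k` steps with the kernels `κ 0, …, κ (k - 1)`, started from the law `ρ`. -/
def iterBind {α : Type*} [MeasurableSpace α] (κ : ℕ → Kernel α α) (ρ : Measure α) :
    ℕ → Measure α
  | 0 => ρ
  | k + 1 => (iterBind κ ρ k).bind (κ k)

theorem iterBind_add {α : Type*} [MeasurableSpace α] (κ : ℕ → Kernel α α) (ρ ρ' : Measure α)
    (k : ℕ) : iterBind κ (ρ + ρ') k = iterBind κ ρ k + iterBind κ ρ' k := by
  induction k with
  | zero => rfl
  | succ k ih => simp only [iterBind, ih, Measure.comp_add]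

theorem iterBind_smul {α : Type*} [MeasurableSpace α] (κ : ℕ → Kernel α α) (a : ℝ≥0∞)
    (ρ : Measure α) (k : ℕ) : iterBind κ (a • ρ) k = a • iterBind κ ρ k := by
  induction k with
  | zero => rfl
  | succ k ih => simp only [iterBind, ih, Measure.comp_smul]

/-- If a fraction `s` of the current law is stationary and `k` steps dominate `a` times the
stationary law `μ'` at the end, then a fraction `s * b + (1 - s) * a` of the final law is
stationary; `b` accounts for the change of the stationary law. -/
theorem smul_le_iterBind {α : Type*} [MeasurableSpace α] {κ : ℕ → Kernel α α} {k : ℕ}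
    {ν μ μ' : Measure α} [IsProbabilityMeasure ν] [IsProbabilityMeasure μ] {s a b : ℝ}
    (hs0 : 0 ≤ s) (hs1 : s ≤ 1) (ha : 0 ≤ a) (hb : 0 ≤ b) (hν : ENNReal.ofReal s • μ ≤ ν)
    (hμ : ENNReal.ofReal b • μ' ≤ iterBind κ μ k)
    (hκ : ∀ ρ ≤ ν, (ρ Set.univ * ENNReal.ofReal a) • μ' ≤ iterBind κ ρ k) :
    ENNReal.ofReal (s * b + (1 - s) * a) • μ' ≤ iterBind κ ν k := by
  have hfin : IsFiniteMeasure (ENNReal.ofReal s • μ) :=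
    ⟨by simp⟩
  have hρ : (ν - ENNReal.ofReal s • μ) Set.univ = ENNReal.ofReal (1 - s) := by
    rw [Measure.sub_apply MeasurableSet.univ hν, Measure.smul_apply, measure_univ, measure_univ,
      smul_eq_mul, mul_one, ENNReal.ofReal_sub _ hs0, ENNReal.ofReal_one]
  -- The minorization is applied only to the remainder ν - sμ, of mass 1 - s; the part sμ is
  -- transported separately.
  have h := hκ _ (Measure.sub_le (μ := ν) (ν := ENNReal.ofReal s • μ))
  rw [hρ] at h
  rw [← Measure.sub_add_cancel_of_le hν, iterBind_add, iterBind_smul,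
    add_comm (iterBind κ _ k),
    ENNReal.ofReal_add (mul_nonneg hs0 hb) (mul_nonneg (sub_nonneg.2 hs1) ha), add_smul,
    ENNReal.ofReal_mul hs0, ENNReal.ofReal_mul (sub_nonneg.2 hs1), mul_smul]
  refine add_le_add ?_ h
  refine Measure.le_iff.2 fun A _ => ?_
  have := hμ A
  rw [Measure.smul_apply, Measure.smul_apply _ (iterBind κ μ k)]
  exact mul_le_mul_right this _

/-- Step `k` preserves the Gibbs law at `β k`, which is then compared with the one at `β (k + 1)`;
the exponents telescope. -/
theorem smul_gibbsProb_le_iterBind (hN : 2 ≤ N) (hγ : 0 < γ) (hb : Bornology.IsBounded E)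
    (hE : MeasurableSet E) (hpos : 0 < volume E) {S : ℕ → Matrix (Fin d) (Fin d) ℝ}
    (hS : ∀ n, (S n).PosDef) {β : ℕ → ℝ} (hβ0 : ∀ n, 0 ≤ β n) (hβ : Monotone β) (k : ℕ) :
    ENNReal.ofReal (Real.exp (-((β k - β 0) * Metric.diam E))) • gibbsProb N E (β k) ≤
      iterBind (fun n => stepKernel E (S n) γ (β n)) (gibbsProb N E (β 0)) k := by
  induction k with
  | zero => simp [iterBind]
  | succ k ih =>
    have h1 := bind_mono_left ih (stepKernel E (S k) γ (β k))
    rw [Measure.comp_smul, gibbsProb_bind_stepKernel hN hγ (hS k) hb hpos] at h1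
    refine le_trans ?_ h1
    have h2 := smul_gibbsProb_le_gibbsProb hN hb hE (hβ0 k) (hβ k.le_succ)
    rw [show -((β (k + 1) - β 0) * Metric.diam E) =
      -((β k - β 0) * Metric.diam E) + -((β (k + 1) - β k) * Metric.diam E) by ring, Real.exp_add,
      ENNReal.ofReal_mul (Real.exp_pos _).le, mul_smul]
    refine Measure.le_iff.2 fun A _ => ?_
    rw [Measure.smul_apply, Measure.smul_apply _ (gibbsProb N E (β k))]
    exact mul_le_mul_right (h2 A) _

/-- Step `j` of the block is used to resample coordinate `j`. All factors are then brought to the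
largest inverse temperature `β N`, which only decreases them. -/
theorem smul_lebN_le_iterBind (hN : 2 ≤ N) (hγ : 0 < γ) (hb : Bornology.IsBounded E)
    (hE : MeasurableSet E) (hpos : 0 < volume E) {S : ℕ → Matrix (Fin d) (Fin d) ℝ}
    (hS : ∀ n, (S n).PosDef) {β : ℕ → ℝ} (hβ0 : ∀ n, 0 ≤ β n) (hβ : Monotone β)
    {c : ℝ} (hc0 : 0 ≤ c) (hc : ∀ n i, ∀ X ∈ designs N E, ∀ Y ∈ designs N E,
      c ≤ proposalDensity E (S n) γ i X Y)
    {ρ : Measure (Design N d)} (hρ : ∀ᵐ X ∂ρ, X ∈ designs N E) :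
    (ρ Set.univ * ENNReal.ofReal (c ^ N * Real.exp (-β N * (N * osc N E)))) • lebN N E ≤
      iterBind (fun n => stepKernel E (S n) γ (β n)) ρ N := by
  have : IsFiniteMeasure (volume.restrict E) := ⟨by simpa using hb.measure_lt_top⟩
  set κ : ℕ → Kernel (Design N d) (Design N d) := fun n => stepKernel E (S n) γ (β n)
  have hae : ∀ k, ∀ᵐ X ∂iterBind κ ρ k, X ∈ designs N E := by
    intro k
    induction k with
    | zero => exact hρ
    | succ k ih => exact ae_mem_designs_bind hN hγ hE ih
  have h := smul_pi_le_of_resample_le (fun _ : Fin N => volume.restrict E) (iterBind κ ρ)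
    (fun j => ENNReal.ofReal (c * Real.exp (-β j * osc N E)))
    fun i f hf => resample_le_bind_stepKernel hN hγ (hS i) hb hE hpos (hβ0 i) hc0 (hc i)
      (hae i) i hf
  rw [← lebN_eq_pi] at h
  refine le_trans ?_ h
  refine Measure.le_iff.2 fun A _ => ?_
  rw [Measure.smul_apply, Measure.smul_apply, smul_eq_mul, smul_eq_mul, mul_comm (ρ Set.univ)]
  refine mul_le_mul_left (mul_le_mul_left ?_ _) _
  rw [← ENNReal.ofReal_prod_of_nonneg fun j _ => mul_nonneg hc0 (Real.exp_pos _).le]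
  refine ENNReal.ofReal_le_ofReal ?_
  calc c ^ N * Real.exp (-β N * (N * osc N E))
      = ∏ _j ∈ Finset.range N, c * Real.exp (-β N * osc N E) := by
        rw [Finset.prod_const, Finset.card_range, mul_pow, ← Real.exp_nat_mul]
        ring_nf
    _ ≤ _ := by
        refine Finset.prod_le_prod (fun j _ => mul_nonneg hc0 (Real.exp_pos _).le) fun j hj => ?_
        have := mul_le_mul_of_nonneg_right (hβ (Finset.mem_range.1 hj).le) (osc_nonneg N E)
        exact mul_le_mul_of_nonneg_left (Real.exp_le_exp.2 (by linarith)) hc0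

/-! ### The logarithmic schedule -/

theorem log_add_exp_one_nonneg (n : ℕ) : 0 ≤ Real.log (n + Real.exp 1) := by
  refine Real.log_nonneg ?_
  have := Real.add_one_le_exp 1
  have := n.cast_nonneg (α := ℝ)
  linarith

theorem monotone_log_add_exp_one : Monotone fun n : ℕ => Real.log (n + Real.exp 1) := by
  intro m n h
  refine Real.log_le_log (by positivity) ?_
  gcongr

/-- The terms are c(r+Nk+e)^(-θ) with θ ≤ 1, hence bounded below by a multiple of the harmonic
series. -/
theorem not_summable_exp_neg_log {θ : ℝ} (hθ1 : θ ≤ 1) {N : ℕ} (r : ℕ) {c : ℝ}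
    (hc : 0 < c) : ¬ Summable fun k : ℕ =>
      c * Real.exp (-(θ * Real.log ((r + N * k : ℕ) + Real.exp 1))) := by
  intro hs
  have hM : 0 < r + N + Real.exp 1 := by positivity
  have hle : ∀ k : ℕ, c / (r + N + Real.exp 1) * (1 / ((k + 1 : ℕ) : ℝ)) ≤
      c * Real.exp (-(θ * Real.log ((r + N * k : ℕ) + Real.exp 1))) := by
    intro k
    have h0 : 0 < ((r + N * k : ℕ) : ℝ) + Real.exp 1 := by positivity
    have h1 : Real.exp (-Real.log ((r + N * k : ℕ) + Real.exp 1)) ≤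
        Real.exp (-(θ * Real.log ((r + N * k : ℕ) + Real.exp 1))) := by
      have := mul_le_mul_of_nonneg_right hθ1 (log_add_exp_one_nonneg (r + N * k))
      exact Real.exp_le_exp.2 (by linarith)
    refine le_trans ?_ (mul_le_mul_of_nonneg_left h1 hc.le)
    rw [Real.exp_neg, Real.exp_log h0, div_mul_div_comm, mul_one, div_eq_mul_inv]
    refine mul_le_mul_of_nonneg_left (inv_anti₀ h0 ?_) hc.le
    push_cast
    have hk : (0 : ℝ) ≤ k := k.cast_nonneg
    have he := Real.exp_pos 1
    have hr : (0 : ℝ) ≤ r := r.cast_nonneg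
    have hN : (0 : ℝ) ≤ N := N.cast_nonneg
    nlinarith [mul_nonneg hr hk, mul_nonneg he.le hk]
  have h2 := hs.of_nonneg_of_le (fun k => by positivity) hle
  rw [summable_mul_left_iff (by positivity)] at h2
  exact Real.not_summable_one_div_natCast ((summable_nat_add_iff 1).1 h2)

/-- The logarithm grows by O(1/n) over a block, which is negligible against n^(-θ) when θ < 1. -/
theorem eventually_log_sub_log_le {θ : ℝ} (hθ : θ < 1) {N : ℕ} {C : ℝ} (hC : 0 ≤ C) {δ : ℝ}
    (hδ : 0 < δ) : ∀ᶠ n : ℕ in atTop,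
      C * (Real.log ((n + N : ℕ) + Real.exp 1) - Real.log (n + Real.exp 1)) ≤
        δ * Real.exp (-(θ * Real.log ((n + N : ℕ) + Real.exp 1))) := by
  have hlim : Tendsto (fun n : ℕ => (1 - θ) * Real.log ((n + N : ℕ) + Real.exp 1)) atTop atTop := by
    refine Tendsto.const_mul_atTop (sub_pos.2 hθ) (Real.tendsto_log_atTop.comp ?_)
    exact tendsto_atTop_add_const_right _ _
      (tendsto_natCast_atTop_atTop.comp (tendsto_add_atTop_nat N))
  -- With u = n+N+e the increment is at most N(N+1)/u, so the claim follows once u^(1-θ) ≥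
  -- CN(N+1)/δ.
  filter_upwards [(Real.tendsto_exp_atTop.comp hlim).eventually_ge_atTop (C * N * (N + 1) / δ)]
    with n hn
  simp only [Function.comp_apply] at hn
  set t : ℝ := n + Real.exp 1 with ht
  set u : ℝ := ((n + N : ℕ) : ℝ) + Real.exp 1 with hu
  have hN : (0 : ℝ) ≤ N := N.cast_nonneg
  have hut : u = t + N := by rw [hu, ht]; push_cast; ring
  have ht1 : 1 ≤ t := by
    have := Real.add_one_le_exp 1
    have := n.cast_nonneg (α := ℝ)
    linarith
  have ht0 : 0 < t := by linarith
  have hu0 : 0 < u := by linarith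
  have h1 : Real.log u - Real.log t ≤ N / t := by
    rw [← Real.log_div hu0.ne' ht0.ne']
    refine (Real.log_le_sub_one_of_pos (by positivity)).trans ?_
    rw [hut]
    field_simp
    linarith
  have h2 : (N : ℝ) / t ≤ N * (N + 1) / u := by
    rw [div_le_div_iff₀ ht0 hu0, hut, mul_assoc]
    refine mul_le_mul_of_nonneg_left ?_ hN
    nlinarith
  have h3 : Real.exp ((1 - θ) * Real.log u) = u * Real.exp (-(θ * Real.log u)) := by
    rw [sub_mul, one_mul, sub_eq_add_neg, Real.exp_add, Real.exp_log hu0]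
  rw [h3, div_le_iff₀ hδ] at hn
  calc C * (Real.log u - Real.log t) ≤ C * (N * (N + 1) / u) :=
        mul_le_mul_of_nonneg_left (h1.trans h2) hC
    _ = C * N * (N + 1) / u := by ring
    _ ≤ u * Real.exp (-(θ * Real.log u)) * δ / u := by gcongr
    _ = _ := by field_simp

end

section

variable {N d : ℕ} {E : Set (Point d)} {γ : ℝ}

/-! ### Convergence of the laws -/

/-- `p k s` will say that the law at block `k` dominates `s` times the Gibbs law. From s' = s b + (1
- s) a one gets 1 - s' ≤ (1 - a)(1 - s) + (1 - b), the contracting recursion. -/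
theorem exists_tendsto_one_of_mix {a b : ℕ → ℝ} (ha0 : ∀ k, 0 ≤ a k) (ha1 : ∀ k, a k ≤ 1)
    (hb0 : ∀ k, 0 ≤ b k) (hb1 : ∀ k, b k ≤ 1) (ha : ¬ Summable a)
    (hab : ∀ δ : ℝ, 0 < δ → ∀ᶠ k in atTop, 1 - b k ≤ δ * a k) {p : ℕ → ℝ → Prop} (h0 : p 0 0)
    (hp : ∀ k s, 0 ≤ s → s ≤ 1 → p k s → p (k + 1) (s * b k + (1 - s) * a k)) :
    ∃ s : ℕ → ℝ, (∀ k, 0 ≤ s k ∧ p k (s k)) ∧ Tendsto s atTop (𝓝 1) := by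
  let s : ℕ → ℝ := fun k => Nat.rec 0 (fun k t => t * b k + (1 - t) * a k) k
  have hs : ∀ k, s (k + 1) = s k * b k + (1 - s k) * a k := fun _ => rfl
  have h : ∀ k, 0 ≤ s k ∧ s k ≤ 1 ∧ p k (s k) := by
    intro k
    induction k with
    | zero => exact ⟨le_rfl, zero_le_one, h0⟩
    | succ k ih =>
      obtain ⟨i0, i1, ip⟩ := ih
      rw [hs]
      refine ⟨?_, ?_, hp k _ i0 i1 ip⟩
      · have := mul_nonneg i0 (hb0 k)
        have := mul_nonneg (sub_nonneg.2 i1) (ha0 k)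
        linarith
      · have := mul_le_mul_of_nonneg_left (hb1 k) i0
        have := mul_le_mul_of_nonneg_left (ha1 k) (sub_nonneg.2 i1)
        linarith
  refine ⟨s, fun k => ⟨(h k).1, (h k).2.2⟩, ?_⟩
  have hlim : Tendsto (fun k => 1 - s k) atTop (𝓝 0) := by
    refine tendsto_zero_of_le_one_sub_mul_add (fun k => sub_nonneg.2 (h k).2.1) ha0 ha1 ha hab
      fun k => ?_
    rw [hs]
    have := mul_le_mul_of_nonneg_right (h k).2.1 (sub_nonneg.2 (hb1 k))
    linarith
  simpa using tendsto_const_nhds.sub hlim (a := (1 : ℝ))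

/-- Lebesgue measure is the intermediary between a block and the Gibbs law. The constant is chosen
before the schedules and `ρ`, so that it serves every block; keeping it at most 1 makes the rates at
most 1. -/
theorem exists_pos_smul_gibbsProb_le_iterBind (hN : 2 ≤ N) (hγ : 0 < γ)
    (hb : Bornology.IsBounded E) (hE : MeasurableSet E) (hpos : 0 < volume E)
    {Sg : Matrix (Fin d) (Fin d) ℝ} (hSg : Sg.PosDef) {τmin : ℝ} (hτmin : 0 < τmin)
    {ε : ℝ} (hε : 0 < ε) :
    ∃ c : ℝ, 0 < c ∧ c ≤ 1 ∧ ∀ τ β : ℕ → ℝ, (∀ n, τmin ≤ τ n) → (∀ n, 0 ≤ β n) → Monotone β →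
      ∀ ρ : Measure (Design N d), (∀ᵐ X ∂ρ, X ∈ designs N E) →
        (ρ Set.univ * ENNReal.ofReal (c * Real.exp (-β N * (N * osc N E + 2 * ε)))) •
          gibbsProb N E (β N) ≤
        iterBind (fun n => stepKernel E (τ n • Sg) γ (β n)) ρ N := by
  have := isFiniteMeasure_lebN (N := N) hb
  obtain ⟨q, hq0, hq⟩ := exists_pos_le_proposalDensity (N := N) hN hγ hSg hb hpos hτmin
  set v := (lebN N E).real {X | U E X < minU N E + ε} with hv
  have hv0 : 0 < v := ENNReal.toReal_pos (lebN_U_lt_pos hpos hε).ne' (measure_ne_top _ _)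
  refine ⟨min 1 (q ^ N * v), lt_min one_pos (by positivity), min_le_left _ _,
    fun τ β hτ hβ0 hβ ρ hρ => ?_⟩
  have h1 := smul_lebN_le_iterBind hN hγ hb hE hpos (S := fun n => τ n • Sg)
    (fun n => hSg.smul (hτmin.trans_le (hτ n))) hβ0 hβ hq0.le (fun n => hq (τ n) (hτ n)) hρ
  refine le_trans ?_ h1
  have h2 := smul_gibbsProb_le_lebN (N := N) hN hb (hβ0 N) hε
  rw [mul_smul, mul_smul]
  refine Measure.le_iff.2 fun A _ => ?_
  have h3 := h2 A
  simp only [Measure.smul_apply, smul_eq_mul] at h3 ⊢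
  refine mul_le_mul_right ?_ _
  refine le_trans ?_ (mul_le_mul_right h3 _)
  rw [← mul_assoc, ← ENNReal.ofReal_mul (by positivity)]
  refine mul_le_mul_left (ENNReal.ofReal_le_ofReal ?_) _
  calc _ ≤ q ^ N * v * Real.exp (-β N * (N * osc N E + 2 * ε)) := by
        gcongr
        exact min_le_right _ _
    _ = _ := by
        rw [mul_add, Real.exp_add]
        ring

theorem tendsto_law_nearOptimal (hN : 2 ≤ N) (hγ : 0 < γ)
    (hb : Bornology.IsBounded E) (hE : MeasurableSet E) (hpos : 0 < volume E)
    {Sg : Matrix (Fin d) (Fin d) ℝ} (hSg : Sg.PosDef) {τ : ℕ → ℝ} {τmin : ℝ} (hτmin : 0 < τmin)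
    (hτ : ∀ n, τmin ≤ τ n) {C : ℝ} (hC : N * osc N E < C) {β : ℕ → ℝ}
    (hβ : ∀ n : ℕ, β n = 1 / C * Real.log (n + Real.exp 1))
    {ν : ℕ → Measure (Design N d)} [∀ n, IsProbabilityMeasure (ν n)]
    (hν : ∀ n, ν (n + 1) = (ν n).bind (stepKernel E (τ n • Sg) γ (β n)))
    (hν0 : ∀ᵐ X ∂ν 0, X ∈ designs N E) {ε : ℝ} (hε : 0 < ε) :
    Tendsto (fun n => (ν n).real (nearOptimal N E ε)) atTop (𝓝 1) := by
  have hosc : 0 ≤ N * osc N E := mul_nonneg N.cast_nonneg (osc_nonneg N E)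
  have hC0 : 0 < C := hosc.trans_lt hC
  have hβ0 : ∀ n, 0 ≤ β n := fun n => by
    rw [hβ]; exact mul_nonneg (by positivity) (log_add_exp_one_nonneg n)
  have hβm : Monotone β := fun m n h => by
    rw [hβ, hβ]; exact mul_le_mul_of_nonneg_left (monotone_log_add_exp_one h) (by positivity)
  have hβtop : Tendsto β atTop atTop := by
    rw [funext hβ]
    exact (Real.tendsto_log_atTop.comp (tendsto_atTop_add_const_right _ _
      tendsto_natCast_atTop_atTop)).const_mul_atTop (by positivity)
  have hD : 0 ≤ Metric.diam E := Metric.diam_nonneg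
  have hμ := fun n => isProbabilityMeasure_gibbsProb hN hb hE hpos (hβ0 n)
  have hmem : ∀ n, ∀ᵐ X ∂ν n, X ∈ designs N E := by
    intro n
    induction n with
    | zero => exact hν0
    | succ n ih => rw [hν]; exact ae_mem_designs_bind hN hγ hE ih
  have hiter : ∀ n k, iterBind (fun j => stepKernel E (τ (n + j) • Sg) γ (β (n + j))) (ν n) k =
      ν (n + k) := by
    intro n k
    induction k with
    | zero => rfl
    | succ k ih => rw [iterBind, ih, ← hν]; rfl
  -- This slack, independent of the target `ε`, uses half of the gap between N·osc and C, so that θ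
  -- < 1.
  set δ := (C - N * osc N E) / 4 with hδ
  have hδ0 : 0 < δ := by rw [hδ]; linarith
  obtain ⟨c, hc0, hc1, hc⟩ :=
    exists_pos_smul_gibbsProb_le_iterBind (N := N) hN hγ hb hE hpos hSg hτmin hδ0
  set θ := (N * osc N E + 2 * δ) / C with hθ
  have hθ0 : 0 ≤ θ := by positivity
  have hθ1 : θ < 1 := by rw [hθ, div_lt_one hC0]; linarith
  have hexp : ∀ n, Real.exp (-β n * (N * osc N E + 2 * δ)) =
      Real.exp (-(θ * Real.log (n + Real.exp 1))) := by
    intro n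
    rw [hβ, hθ]
    congr 1
    ring
  -- For the block from `n` to `n + N`, `a n` is the rate of conversion to the Gibbs law and `b n`
  -- the fraction surviving the drift of that law.
  let a : ℕ → ℝ := fun n => c * Real.exp (-(θ * Real.log ((n + N : ℕ) + Real.exp 1)))
  let b : ℕ → ℝ := fun n => Real.exp (-((β (n + N) - β n) * Metric.diam E))
  have ha0 : ∀ n, 0 ≤ a n := fun n => by positivity
  have ha1 : ∀ n, a n ≤ 1 := fun n => by
    refine mul_le_one₀ hc1 (Real.exp_pos _).le (Real.exp_le_one_iff.2 ?_)
    have := mul_nonneg hθ0 (log_add_exp_one_nonneg (n + N))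
    linarith
  have hb1 : ∀ n, b n ≤ 1 := fun n => by
    refine Real.exp_le_one_iff.2 ?_
    have := mul_nonneg (sub_nonneg.2 (hβm (Nat.le_add_right n N))) hD
    linarith
  have hab : ∀ η : ℝ, 0 < η → ∀ᶠ n in atTop, 1 - b n ≤ η * a n := by
    intro η hη
    filter_upwards [eventually_log_sub_log_le hθ1 (N := N) (C := Metric.diam E / C) (by positivity)
      (mul_pos hη hc0)] with n hn
    have h1 : 1 - b n ≤ (β (n + N) - β n) * Metric.diam E := by
      have := Real.add_one_le_exp (-((β (n + N) - β n) * Metric.diam E))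
      simp only [b]
      linarith
    have h2 : (β (n + N) - β n) * Metric.diam E = Metric.diam E / C *
        (Real.log ((n + N : ℕ) + Real.exp 1) - Real.log (n + Real.exp 1)) := by
      rw [hβ, hβ]; ring
    rw [h2] at h1
    refine (h1.trans hn).trans (le_of_eq ?_)
    simp only [a]
    ring
  have hstep : ∀ n s, 0 ≤ s → s ≤ 1 → ENNReal.ofReal s • gibbsProb N E (β n) ≤ ν n →
      ENNReal.ofReal (s * b n + (1 - s) * a n) • gibbsProb N E (β (n + N)) ≤ ν (n + N) := by
    intro n s hs0 hs1 hs
    rw [← hiter n N]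
    refine smul_le_iterBind hs0 hs1 (ha0 n) (Real.exp_pos _).le hs ?_ fun ρ hρ => ?_
    · exact smul_gibbsProb_le_iterBind hN hγ hb hE hpos (S := fun j => τ (n + j) • Sg)
        (fun j => hSg.smul (hτmin.trans_le (hτ _))) (β := fun j => β (n + j)) (fun j => hβ0 _)
        (fun i j h => hβm (by omega)) N
    · have h := hc (fun j => τ (n + j)) (fun j => β (n + j)) (fun j => hτ _) (fun j => hβ0 _)
        -- Being dominated by `ν n`, the measure `ρ` is also carried by E^N.
        (fun i j h => hβm (by omega)) ρ (Measure.absolutelyContinuous_of_le hρ (hmem n))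
      rwa [hexp] at h
  refine tendsto_of_forall_residue (show 0 < N by omega) fun r _ => ?_
  have hr : Tendsto (fun k => r + N * k) atTop atTop :=
    tendsto_atTop_mono (fun k => (Nat.le_mul_of_pos_left k (by omega)).trans
      (Nat.le_add_left _ r)) tendsto_id
  obtain ⟨s, hs, hs1⟩ := exists_tendsto_one_of_mix (a := fun k => a (r + N * k))
    (b := fun k => b (r + N * k)) (fun k => ha0 _) (fun k => ha1 _) (fun k => (Real.exp_pos _).le)
    (fun k => hb1 _)
    (by
      -- The offset is `r + N` because the rate of a block involves the inverse temperature at its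
      -- end.
      have h := not_summable_exp_neg_log hθ1.le (N := N) (r + N) hc0
      simpa only [a, add_right_comm r N] using h)
    (fun η hη => hr.eventually (hab η hη))
    (p := fun k s => ENNReal.ofReal s • gibbsProb N E (β (r + N * k)) ≤ ν (r + N * k))
    (by simpa using Measure.zero_le _)
    (fun k s hs0 hs1 h => by simpa only [Nat.mul_succ, add_assoc] using hstep _ s hs0 hs1 h)
  -- The probability of near-optimality is at least s_k times its Gibbs probability, and both
  -- factors tend to 1.
  have hlow := hs1.mul
    ((tendsto_gibbsProb_nearOptimal hN hb hE hpos hε).comp (hβtop.comp hr))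
  rw [one_mul] at hlow
  refine tendsto_of_tendsto_of_tendsto_of_le_of_le hlow tendsto_const_nhds (fun k => ?_)
    fun k => measureReal_le_one
  have h := ENNReal.toReal_mono (measure_ne_top _ _) ((hs k).2 (nearOptimal N E ε))
  rwa [Measure.smul_apply, smul_eq_mul, ENNReal.toReal_mul, ENNReal.toReal_ofReal (hs k).1] at h

end

end Maximin

end

/-! ### From the laws to the chain -/

theorem mainTheorem1 {N d : ℕ} (hN : 2 ≤ N)
    (E : Set (Maximin.Point d)) (hE_meas : MeasurableSet E) (hE_bdd : Bornology.IsBounded E)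
    (hE_pos : 0 < volume E)
    (Sg : Matrix (Fin d) (Fin d) ℝ) (hSg : Sg.PosDef)
    (γ : ℝ) (hγ : 0 < γ)
    (τ : ℕ → ℝ) (τmin : ℝ) (hτmin : 0 < τmin) (hτ : ∀ n, τ n ≤ τ 0 ∧ τmin ≤ τ n)
    (C : ℝ) (hC : N * Maximin.osc N E < C)
    (β : ℕ → ℝ) (hβ : ∀ n : ℕ, β n = 1 / C * Real.log (n + Real.exp 1))
    (η : Measure (Maximin.Design N d)) [IsProbabilityMeasure η]
    (hη : ∀ᵐ X ∂η, X ∈ Maximin.designs N E)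
    {Ω : Type*} [MeasurableSpace Ω] (P : Measure Ω) [IsProbabilityMeasure P]
    (X : ℕ → Ω → Maximin.Design N d)
    (hX : Maximin.IsMarkovChain P η
      (fun n => Maximin.stepKernel E (τ n • Sg) γ (β n)) X) :
    ∀ ε : ℝ, 0 < ε →
      Tendsto (fun n => P {ω | X n ω ∈ Maximin.nearOptimal N E ε}) atTop (𝓝 1) := by
  intro ε hε
  have hκ : ∀ n, IsMarkovKernel
      (Maximin.stepKernel E (τ n • Sg) γ (β n) : Kernel (Maximin.Design N d) _) := fun n =>
    Maximin.isMarkovKernel_stepKernel hN hγ (hSg.smul (hτmin.trans_le (hτ n).2)) hE_bdd hE_pos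
  have hprob : ∀ n, IsProbabilityMeasure (P.map (X n)) := fun n =>
    Measure.isProbabilityMeasure_map (hX.measurable n).aemeasurable
  have h := Maximin.tendsto_law_nearOptimal hN hγ hE_bdd hE_meas hE_pos hSg hτmin
    (fun n => (hτ n).2) hC hβ (ν := fun n => P.map (X n)) hX.map_succ
    (by rw [hX.initial]; exact hη) hε
  have h' := ENNReal.tendsto_ofReal h
  rw [ENNReal.ofReal_one] at h'
  refine h'.congr fun n => ?_
  rw [ofReal_measureReal, Measure.map_apply (hX.measurable n)
    (Maximin.measurableSet_nearOptimal hE_meas ε)]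
  rfl
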